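/- **Definitions.** A *bar partition* is a (possibly empty) partition $\lambda=(a_1>\dots>a_m>0)$ into distinct parts; $\mathcal P(\lambda)=\{a_1,\dots,a_m\}$. Unions and differences of multisets below count multiplicities. The multiset of *bar lengths* of $\lambda$ is $$\mathcal B(\lambda)=\bigcup_{1\le i\le m}\{1,\dots,a_i\}\cup\{a_i+a_j\mid j>i\}\setminus\{a_i-a_j\mid j>i\}.$$ Removing a bar of length $k\ge1$ from $\lambda$ means: replacing a part $a>k$ by $a-k$ where $a-k$ is not a part, or deleting the part $k$, or deleting two distinct parts of sum $k$. Let $d\ge3$ be odd. A *$\bar d$-core* of $\lambda$ is a bar partition obtained from $\lambda$ by successive removals of bars of lengths divisible by $d$, and having itself no bar length divisible by $d$. The *doubled partition* $D(\lambda)$ is the partition with Frobenius symbol $(a_1,\dots,a_m\mid a_1-1,\dots,a_m-1)$. The node in row $r$ and column $s$ of a Young diagram has residue $s-r \bmod d$. Take the first-column beta-set $X$ of $D(\lambda)$ whose size is the least multiple of $d$ that is at least the number of rows, and place its elements as beads on an abacus with runners $0,\dots,d-1$ (the bead $a$ on runner $a\bmod d$ in position $\lfloor a/d\rfloor$). Let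 $x_i$ be the number of beads on runner $i$. The positions of the beads on runner $i$ form a beta-set of a partition, and these $d$ partitions form the $d$-quotient of $D(\lambda)$; it has the form $(D(\mu_0),\mu_1,\dots,\mu_{(d-1)/2},\mu_{(d-1)/2}^*,\dots,\mu_1^*)$, with $^*$ denoting conjugation. The *$\bar d$-quotient* of $\lambda$ is $(\mu_0,\mu_1,\dots,\mu_{(d-1)/2})$. A *$\bar d$-quotient partition* of $\lambda$ is a bar partition with empty $\bar d$-core and the same $\bar d$-quotient as $\lambda$. For a bar partition $q$ with $m(q)$ parts, let $B(q)$ be the set of hooks of $D(q)$ whose corner lies strictly to the right of the main diagonal, and $P(q)\subseteq B(q)$ the set of those with corner in column $m(q)+1$ (their lengths are the parts of $q$). If $q$ is a $\bar d$-quotient partition of $\lambda$, and $z$ is a hook of $D(q)$ of length $h(z)$ whose hand node has residue $i$ and whose foot node has residue $j+1 \bmod d$ ($0\le i,j\le d-1$), put $\bar h(z)=h(z)+(x_i-x_j)d$, with the $x_i$ of $D(\lambda)$. Let $\bar{\mathcal B}(q)$ and $\bar{\mathcal P}(q)$ be the multisets of the absolute values $|\bar h(z)|$ for $z\in B(q)$,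 respectively $z\in P(q)$. For a multiset $A$ put $A^{\times2}=\{2a\mid a\in A\}$. **Theorem.** Let $\lambda$ be a bar partition and $d\ge3$ an odd integer. Then $\lambda$ has exactly one $\bar d$-core $\bar c_d(\lambda)$ and exactly one $\bar d$-quotient partition $\bar q_d(\lambda)$, the multiset $\mathcal P(\bar c_d(\lambda))\cap\bar{\mathcal P}(\bar q_d(\lambda))$ is contained in $\bar{\mathcal B}(\bar q_d(\lambda))$, and $$\mathcal B(\lambda)=\mathcal B(\bar c_d(\lambda))\cup\tilde{\mathcal B}(\bar q_d(\lambda)),$$ where $$\tilde{\mathcal B}(\bar q_d(\lambda))=\bar{\mathcal B}(\bar q_d(\lambda))\setminus[\mathcal P(\bar c_d(\lambda))\cap\bar{\mathcal P}(\bar q_d(\lambda))]\cup[\mathcal P(\bar c_d(\lambda))\cap\bar{\mathcal P}(\bar q_d(\lambda))]^{\times2}.$$ -/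

import Mathlib

/-- A bar partition: a partition into distinct positive parts, given by its set of parts.
The empty one is allowed, as cores and quotient partitions may be empty. -/
@[ext]
structure BarPartition where
  parts : Finset ℕ
  pos : ∀ a ∈ parts, 0 < a

namespace BarPartition

/-- The empty bar partition. -/
def empty : BarPartition := ⟨∅, by simp⟩

/-- The multiset of bar lengths: the union over the parts `a` of
`{1, …, a} ∪ {a + b | b < a a part} \ {a - b | b < a a part}`. -/
def barLengths (l : BarPartition) : Multiset ℕ :=
  ∑ a ∈ l.parts,
    ((Finset.Icc 1 a).val + (l.parts.filter (· < a)).val.map (fun b => a + b)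
      - (l.parts.filter (· < a)).val.map (fun b => a - b))

/-! ### Removing bars, and the bar core -/

/-- `BarRemoval k l m`: the bar partition `m` is obtained from `l` by removing a bar of length `k`.
The bar is unmixed of type 1 (a part `a > k` becomes `a - k`, which was not a part), unmixed of
type 2 (the part `k` is removed), or mixed (two distinct parts of sum `k` are removed). -/
def BarRemoval (k : ℕ) (l m : BarPartition) : Prop :=
  (∃ a ∈ l.parts, 0 < k ∧ k < a ∧ a - k ∉ l.parts ∧ m.parts = insert (a - k) (l.parts.erase a)) ∨
  (k ∈ l.parts ∧ m.parts = l.parts.erase k) ∨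
  (∃ a ∈ l.parts, ∃ b ∈ l.parts, b < a ∧ a + b = k ∧ m.parts = (l.parts.erase a).erase b)

/-- `c` is a bar core of `l` for `d`: it is obtained from `l` by successively removing bars of
length divisible by `d`, and has itself no bar of length divisible by `d`. -/
def IsBarCore (d : ℕ) (l c : BarPartition) : Prop :=
  Relation.ReflTransGen (fun x y => ∃ k, d ∣ k ∧ BarRemoval k x y) l c ∧
    ∀ k ∈ c.barLengths, ¬ d ∣ k

/-! ### The doubled partition -/

/-- The (zero-based) position of the part `a` when the parts are listed in decreasing order. -/
def idx (l : BarPartition) (a : ℕ) : ℕ := (l.parts.filter (a < ·)).card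

/-- The cells of the Young diagram with Frobenius symbol `(a₁, …, aₘ | a₁ - 1, …, aₘ - 1)`: the
`k`-th diagonal cell has arm length `aₖ` and leg length `aₖ - 1`. -/
def doublingCells (l : BarPartition) : Finset (ℕ × ℕ) :=
  l.parts.biUnion fun a =>
    (Finset.range (a + 1)).image (fun t => (l.idx a, l.idx a + t)) ∪
    (Finset.range a).image (fun t => (l.idx a + t, l.idx a))

theorem mem_doublingCells (l : BarPartition) (i j : ℕ) :
    (i, j) ∈ l.doublingCells ↔ ∃ a ∈ l.parts,
      (i = l.idx a ∧ i ≤ j ∧ j ≤ i + a) ∨ (j = l.idx a ∧ j ≤ i ∧ i < j + a) := by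
  simp only [doublingCells, Finset.mem_biUnion, Finset.mem_union, Finset.mem_image,
    Finset.mem_range, Prod.mk.injEq]
  refine exists_congr fun a => and_congr_right fun _ => or_congr ?_ ?_
  · exact ⟨fun ⟨t, h, h1, h2⟩ => by omega, fun h => ⟨j - i, by omega⟩⟩
  · exact ⟨fun ⟨t, h, h1, h2⟩ => by omega, fun h => ⟨i - j, by omega⟩⟩

theorem idx_lt_idx (l : BarPartition) {a b : ℕ} (hb : b ∈ l.parts) (h : a < b) :
    l.idx b < l.idx a := by
  refine Finset.card_lt_card ((Finset.ssubset_iff_of_subset ?_).2 ⟨b, by simp [hb, h], by simp⟩)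
  intro c
  simp only [Finset.mem_filter]
  exact fun hc => ⟨hc.1, h.trans hc.2⟩

theorem add_idx_le (l : BarPartition) {a b : ℕ} (h : a ≤ b) : a + l.idx a ≤ b + l.idx b := by
  have h1 : l.parts.filter (a < ·) ⊆ l.parts.filter (b < ·) ∪ Finset.Ioc a b := by
    intro c
    simp only [Finset.mem_filter, Finset.mem_union, Finset.mem_Ioc]
    intro hc
    by_cases hcb : c ≤ b
    · exact Or.inr ⟨hc.2, hcb⟩
    · exact Or.inl ⟨hc.1, by omega⟩
  have h2 := (Finset.card_le_card h1).trans (Finset.card_union_le _ _)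
  rw [Nat.card_Ioc] at h2
  unfold idx
  omega

theorem idx_lt_card (l : BarPartition) {a : ℕ} (ha : a ∈ l.parts) :
    l.idx a < l.parts.card :=
  Finset.card_lt_card ((Finset.ssubset_iff_of_subset (Finset.filter_subset _ _)).2
    ⟨a, ha, by simp⟩)

theorem exists_idx_eq (l : BarPartition) {k : ℕ} (hk : k < l.parts.card) :
    ∃ a ∈ l.parts, l.idx a = k := by
  have hinj : Set.InjOn l.idx l.parts := by
    intro a ha b hb hab
    rcases lt_trichotomy a b with h | h | h
    · exact absurd (l.idx_lt_idx hb h) (by omega)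
    · exact h
    · exact absurd (l.idx_lt_idx ha h) (by omega)
  have himg : l.parts.image l.idx = Finset.range l.parts.card := by
    refine Finset.eq_of_subset_of_card_le ?_ ?_
    · intro x hx
      obtain ⟨a, ha, rfl⟩ := Finset.mem_image.1 hx
      exact Finset.mem_range.2 (l.idx_lt_card ha)
    · rw [Finset.card_image_of_injOn hinj, Finset.card_range]
  have hmem : k ∈ l.parts.image l.idx := by rw [himg]; exact Finset.mem_range.2 hk
  simpa using hmem

theorem isLowerSet_doublingCells (l : BarPartition) :
    IsLowerSet (l.doublingCells : Set (ℕ × ℕ)) := by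
  rintro ⟨i, j⟩ ⟨i', j'⟩ ⟨hi, hj⟩ h
  simp only [Finset.mem_coe, mem_doublingCells] at h ⊢
  simp only at hi hj
  obtain ⟨a, ha, h⟩ := h
  have hlt := l.idx_lt_card ha
  obtain ⟨b, hb, hbk⟩ := l.exists_idx_eq (k := min i' j') (by omega)
  have hab : a ≤ b := by
    by_contra hcon
    have := l.idx_lt_idx ha (not_le.1 hcon)
    omega
  have := l.add_idx_le hab
  have := l.pos a ha
  exact ⟨b, hb, by omega⟩

/-- The doubled partition, as a Young diagram (rows and columns numbered from zero). -/
def doubling (l : BarPartition) : YoungDiagram := ⟨l.doublingCells, l.isLowerSet_doublingCells⟩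

/-- The cells of the shifted Young diagram, inside the doubled partition: those strictly to the
right of the diagonal. Their hooks are the bars. -/
def shiftedCells (l : BarPartition) : Finset (ℕ × ℕ) :=
  l.doubling.cells.filter fun z => z.1 < z.2

/-- The cells whose hooks correspond to the parts: those in the first column to the right of the
last diagonal cell. -/
def partCells (l : BarPartition) : Finset (ℕ × ℕ) :=
  l.doubling.cells.filter fun z => z.2 = l.parts.card

end BarPartition

/-! ### Hooks, beta-sets and the abacus -/

namespace YoungDiagram

/-- The length of the hook with corner `z`. -/
def hookLen (Y : YoungDiagram) (z : ℕ × ℕ) : ℤ :=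
  (Y.rowLen z.1 : ℤ) - z.2 + (Y.colLen z.2 - z.1) - 1

/-- The residue of the node `z` modulo `d`. -/
def nodeResidue (d : ℕ) (z : ℕ × ℕ) : ZMod d := (z.2 : ZMod d) - (z.1 : ZMod d)

/-- The residue of the hand node (the last node of the row) of the hook with corner `z`. -/
def handResidue (Y : YoungDiagram) (d : ℕ) (z : ℕ × ℕ) : ZMod d :=
  nodeResidue d (z.1, Y.rowLen z.1 - 1)

/-- The residue of the foot node (the last node of the column) of the hook with corner `z`. -/
def footResidue (Y : YoungDiagram) (d : ℕ) (z : ℕ × ℕ) : ZMod d :=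
  nodeResidue d (Y.colLen z.2 - 1, z.2)

/-- The beta-set of `Y` with `N` elements, for `N` at least the number of rows. -/
def betaSet (Y : YoungDiagram) (N : ℕ) : Finset ℕ :=
  (Finset.range N).image fun r => Y.rowLen r + (N - 1 - r)

/-- The minimal normalized beta-set: its size is the least multiple of `d` which is at least the
number of rows. -/
def normBetaSet (Y : YoungDiagram) (d : ℕ) : Finset ℕ :=
  Y.betaSet (d * ((Y.colLen 0 + d - 1) / d))

/-- The number of beads on the runner `i` of the minimally normalized abacus with `d` runners. -/
def beads (Y : YoungDiagram) (d : ℕ) (i : ZMod d) : ℕ :=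
  ((Y.normBetaSet d).filter fun a : ℕ => (a : ZMod d) = i).card

/-- The positions of the beads on the runner `i < d`. -/
def runner (Y : YoungDiagram) (d i : ℕ) : Finset ℕ :=
  ((Y.normBetaSet d).filter fun a => a % d = i).image (· / d)

/-- The partition (as the multiset of its positive parts) with beta-set `X`: each bead `b`
contributes the number of empty positions below it. -/
def partitionOfBeta (X : Finset ℕ) : Multiset ℕ :=
  (X.val.map fun b => ((Finset.range b).filter (· ∉ X)).card).filter (0 < ·)

/-- The component of index `i < d` of the `d`-quotient. -/
def quotientComponent (Y : YoungDiagram) (d i : ℕ) : Multiset ℕ :=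
  partitionOfBeta (Y.runner d i)

end YoungDiagram

namespace BarPartition

/-- `q` has the same bar quotient as `l`. The bar quotient of `l` is
`(μ₀, μ₁, …, μ_{(d-1)/2})`, where `D(μ₀), μ₁, …, μ_{(d-1)/2}` are the first `(d+1)/2` components of
the `d`-quotient of the doubled partition `D(l)`; as `D` is injective, `μ₀` is determined by
`D(μ₀)`, and conversely. -/
def SameBarQuotient (d : ℕ) (l q : BarPartition) : Prop :=
  ∀ i ≤ (d - 1) / 2, q.doubling.quotientComponent d i = l.doubling.quotientComponent d i

/-- `q` is the bar quotient partition of `l`: it has an empty bar core, and the same bar quotient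
as `l`. -/
def IsBarQuotientPartition (d : ℕ) (l q : BarPartition) : Prop :=
  IsBarCore d q empty ∧ SameBarQuotient d l q

/-- The modified length `h(z) + (xᵢ - xⱼ) d` of the hook `z` of the doubled partition of `q`, where
`i` is the hand residue and `j + 1` the foot residue of `z`, and the `xᵢ` are the numbers of beads
on the runners of the abacus of the doubled partition of `l`. -/
def modHook (d : ℕ) (l q : BarPartition) (z : ℕ × ℕ) : ℤ :=
  q.doubling.hookLen z +
    ((l.doubling.beads d (q.doubling.handResidue d z) : ℤ) -
      l.doubling.beads d (q.doubling.footResidue d z - 1)) * d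

/-- The multiset of absolute values of the modified bar lengths of `q`. -/
def modBarLengths (d : ℕ) (l q : BarPartition) : Multiset ℕ :=
  q.shiftedCells.val.map fun z => (modHook d l q z).natAbs

/-- The absolute values of the modified bar lengths of the bars of `q` that correspond to parts. -/
def modPartLengths (d : ℕ) (l q : BarPartition) : Multiset ℕ :=
  q.partCells.val.map fun z => (modHook d l q z).natAbs

/-- The common values of the parts of `c` and the modified parts of `q`. -/
def commonParts (d : ℕ) (l c q : BarPartition) : Multiset ℕ :=
  c.parts.val ∩ modPartLengths d l q

/-- The modified bar lengths of `q`, with the common values removed and their doubles added. -/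
def adjBarLengths (d : ℕ) (l c q : BarPartition) : Multiset ℕ :=
  modBarLengths d l q - commonParts d l c q + (commonParts d l c q).map (fun a => 2 * a)

end BarPartition

/-!
The theorem is a statement about subsets of `ℤ`. A bar partition `l` is encoded by its Maya diagram
`T`: a positive integer lies in `T` when it is a part, and `x ≤ 0` lies in `T` when `-x` is not a
part. Thus `0 ∈ T`, exactly one of `x`, `-x` lies in `T` for `x ≠ 0`, and the bars of `l` are the
pairs of distinct elements of `T` with positive sum, the sum being the bar length
(`barLengths_eq`). Up to the point `0`, the beads and gaps of the doubled partition are `T` and its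
complement (`exists_rowBead_iff`, `exists_colGap_iff`); the shifted cells are the same pairs
(`map_shiftedCells`), and the numbers of beads on the runners are, up to a common constant, the
charges `c i`, which count the elements of `T` in each class modulo `d` relative to the
non-positive integers (`exists_beads_eq`).

Let `φ` move the class `i` by `c i` steps of length `d`; it is odd, since `c (-i) = -c i`. Removing
bars of length divisible by `d` preserves the charges, and a Maya diagram without such bars is
closed under subtraction of `d`. So the Maya diagram of the bar core is `φ` of the non-positive
integers (`IsBarCore.mem_maya_iff`). The components of the quotient determine the runners up to
translation, so the Maya diagram of the bar quotient partition is the preimage of `T` under `φ`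
(`isBarQuotientPartition_iff`), and the modified length of the bar `{u, v}` of the quotient
partition is `|φ u + φ v|`.

It remains to count, for `k > 0`, the pairs `{x, k - x}` in `T`. Those with
`φ⁻¹ x + φ⁻¹ (k - x) > 0` are modified bars. The others are compared with the modified bars of
signed length `-k` by means of `x ↦ -x`, which away from `0` exchanges `T` and its complement. The
difference is a sum of the indicator function of `T` over classes modulo `d`, since the sign of
`φ⁻¹ x + φ⁻¹ (k - x)` depends only on the class of `x`. Hence it does not change when `T` is
replaced by the Maya diagram of the core (`sum_class_function_eq_zero`), for which it is the number
of bars of length `k` of the core. The exceptional behaviour of `0`, which lies in `T` and in `-T`,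
removes the common parts equal to `k`, and the degenerate pairs `x = k - x` add the common parts
equal to `k / 2` (`count_barLengths_eq`).
-/

/-! ### The Maya diagram and the charges of a bar partition -/

namespace BarPartition

/-- The Maya diagram of a bar partition: the positive elements are the parts, and a number `x ≤ 0`
belongs to it when `-x` is not a part. Away from `0` it contains exactly one of `x` and `-x`; by
convention it contains `0`, so that the bars become the pairs of elements with positive sum. -/
def maya (l : BarPartition) : Set ℤ :=
  {x | 0 < x ∧ x.natAbs ∈ l.parts ∨ x ≤ 0 ∧ x.natAbs ∉ l.parts}

instance (l : BarPartition) : DecidablePred (· ∈ l.maya) := fun x =>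
  inferInstanceAs (Decidable (0 < x ∧ x.natAbs ∈ l.parts ∨ x ≤ 0 ∧ x.natAbs ∉ l.parts))

theorem mem_maya {l : BarPartition} {x : ℤ} :
    x ∈ l.maya ↔ 0 < x ∧ x.natAbs ∈ l.parts ∨ x ≤ 0 ∧ x.natAbs ∉ l.parts := Iff.rfl

theorem zero_notMem_parts (l : BarPartition) : 0 ∉ l.parts := fun h => (l.pos 0 h).ne' rfl

theorem zero_mem_maya (l : BarPartition) : (0 : ℤ) ∈ l.maya :=
  Or.inr ⟨le_rfl, l.zero_notMem_parts⟩

theorem mem_maya_of_pos {l : BarPartition} {x : ℤ} (hx : 0 < x) :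
    x ∈ l.maya ↔ x.natAbs ∈ l.parts := by
  simp [mem_maya, hx, hx.not_ge]

theorem mem_maya_of_nonpos {l : BarPartition} {x : ℤ} (hx : x ≤ 0) :
    x ∈ l.maya ↔ x.natAbs ∉ l.parts := by
  simp [mem_maya, hx, hx.not_gt]

theorem natCast_mem_maya {l : BarPartition} {a : ℕ} (ha : 0 < a) :
    (a : ℤ) ∈ l.maya ↔ a ∈ l.parts := by
  rw [mem_maya_of_pos (by omega), Int.natAbs_natCast]

theorem neg_mem_maya {l : BarPartition} {x : ℤ} (hx : x ≠ 0) : -x ∈ l.maya ↔ x ∉ l.maya := by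
  rcases lt_or_gt_of_ne hx with h | h
  · rw [mem_maya_of_pos (by omega), mem_maya_of_nonpos h.le, Int.natAbs_neg, not_not]
  · rw [mem_maya_of_nonpos (by omega), mem_maya_of_pos h, Int.natAbs_neg]

theorem eq_of_maya_eq {l m : BarPartition} (h : ∀ x, x ∈ l.maya ↔ x ∈ m.maya) : l = m := by
  ext a
  rcases Nat.eq_zero_or_pos a with rfl | ha
  · exact iff_of_false l.zero_notMem_parts m.zero_notMem_parts
  · rw [← natCast_mem_maya ha, ← natCast_mem_maya ha, h]

/-- The largest part, or `0` if there are no parts. -/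
def bound (l : BarPartition) : ℕ := l.parts.sup id

theorem le_bound {l : BarPartition} {a : ℕ} (ha : a ∈ l.parts) : a ≤ l.bound :=
  Finset.le_sup (f := id) ha

theorem le_bound_of_mem_maya {l : BarPartition} {x : ℤ} (hx : x ∈ l.maya) : x ≤ l.bound := by
  rcases hx with h | h
  · have := le_bound h.2
    omega
  · omega

/-- The charge of the residue class `i`: the number of parts in the class `i` minus the number of
parts in the class `-i`. It counts the elements of the Maya diagram in the class `i`, relative to
the non-positive integers. -/
def charge (d : ℕ) (l : BarPartition) (i : ZMod d) : ℤ :=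
  ∑ a ∈ l.parts, ((if (a : ZMod d) = i then 1 else 0) - (if -(a : ZMod d) = i then 1 else 0))

theorem charge_neg (d : ℕ) (l : BarPartition) (i : ZMod d) :
    l.charge d (-i) = -l.charge d i := by
  rw [charge, charge, ← Finset.sum_neg_distrib]
  refine Finset.sum_congr rfl fun a _ => ?_
  have h : (a : ZMod d) = -i ↔ -(a : ZMod d) = i := eq_neg_iff_add_eq_zero.trans
    (by rw [neg_eq_iff_add_eq_zero])
  simp only [h, neg_inj]
  ring

theorem charge_eq_sum (d : ℕ) (l : BarPartition) (i : ZMod d) (W : Finset ℤ)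
    (hW : ∀ x : ℤ, x.natAbs ∈ l.parts → x ∈ W) :
    ∑ x ∈ W.filter (fun x : ℤ => (x : ZMod d) = i),
      (((if x ∈ l.maya then 1 else 0) - (if x ≤ 0 then 1 else 0) : ℤ)) = l.charge d i := by
  rw [Finset.sum_filter]
  have hsub : l.parts.image (fun a : ℕ => (a : ℤ)) ∪ l.parts.image (fun a : ℕ => -(a : ℤ)) ⊆ W := by
    intro x hx
    simp only [Finset.mem_union, Finset.mem_image] at hx
    rcases hx with ⟨a, ha, rfl⟩ | ⟨a, ha, rfl⟩ <;> exact hW _ (by simpa using ha)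
  have hdis : Disjoint (l.parts.image (fun a : ℕ => (a : ℤ)))
      (l.parts.image (fun a : ℕ => -(a : ℤ))) := by
    rw [Finset.disjoint_left]
    intro x hx hx'
    simp only [Finset.mem_image] at hx hx'
    obtain ⟨a, ha, rfl⟩ := hx
    obtain ⟨b, hb, hab⟩ := hx'
    have := l.pos a ha
    omega
  rw [← Finset.sum_subset hsub, Finset.sum_union hdis, Finset.sum_image (by simp),
    Finset.sum_image (by simp), ← Finset.sum_add_distrib, charge]
  · refine Finset.sum_congr rfl fun a ha => ?_
    have hpos := l.pos a ha
    have h1 : (a : ℤ) ∈ l.maya := (natCast_mem_maya hpos).2 ha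
    have h2 : -(a : ℤ) ∉ l.maya := by rw [neg_mem_maya (by omega)]; simpa using h1
    have h3 : ¬ (a : ℤ) ≤ 0 := by omega
    have h4 : -(a : ℤ) ≤ 0 := by omega
    simp only [h1, h2, h3, h4, if_true, if_false, Int.cast_neg, Int.cast_natCast]
    split_ifs <;> norm_num
  · intro x _ hx
    have hx' : x.natAbs ∉ l.parts := by
      intro h
      apply hx
      simp only [Finset.mem_union, Finset.mem_image]
      rcases le_total 0 x with h0 | h0
      · exact Or.inl ⟨_, h, by omega⟩
      · exact Or.inr ⟨_, h, by omega⟩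
    have : x ∈ l.maya ↔ x ≤ 0 := by simp [mem_maya, hx']
    simp [this]

theorem abs_charge_le (d : ℕ) (l : BarPartition) (i : ZMod d) :
    |l.charge d i| ≤ l.parts.card := by
  refine (Finset.abs_sum_le_sum_abs _ _).trans ?_
  rw [Finset.card_eq_sum_ones, Nat.cast_sum]
  refine Finset.sum_le_sum fun a _ => ?_
  split_ifs <;> norm_num

end BarPartition

/-! ### Sliding the residue classes -/

/-- The permutation of `ℤ` that moves every residue class `i` modulo `d` by `c i` steps of
length `d`. Its inverse is `slide d (-c)`. -/
def slide (d : ℕ) (c : ZMod d → ℤ) (x : ℤ) : ℤ := x + c x * d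

section slide

variable {d : ℕ} {c : ZMod d → ℤ}

theorem slide_cast (x : ℤ) : ((slide d c x : ℤ) : ZMod d) = x := by
  simp [slide]

theorem slide_neg_slide (x : ℤ) : slide d (-c) (slide d c x) = x := by
  rw [slide, slide_cast, slide, Pi.neg_apply]
  ring

theorem slide_slide_neg (x : ℤ) : slide d c (slide d (-c) x) = x := by
  simpa using slide_neg_slide (c := -c) x

theorem slide_neg (hc : ∀ i, c (-i) = -c i) (x : ℤ) : slide d c (-x) = -slide d c x := by
  simp only [slide, Int.cast_neg, hc]
  ring

theorem slide_injective : Function.Injective (slide d c) :=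
  Function.LeftInverse.injective slide_neg_slide

theorem slide_zero (hc : ∀ i, c (-i) = -c i) : slide d c 0 = 0 := by
  have := slide_neg hc 0
  rw [neg_zero] at this
  omega

theorem slide_eq_zero (hc : ∀ i, c (-i) = -c i) {x : ℤ} : slide d c x = 0 ↔ x = 0 := by
  rw [← slide_zero hc]
  exact slide_injective.eq_iff.trans (by rw [slide_zero hc])

end slide

/-- Moving the half-line `x ≤ 0` by `c` steps in one residue class changes the number of its
elements by `c`. -/
theorem sum_shifted_halfLine {d : ℕ} (hd : 0 < d) (c : ℤ) (i : ZMod d) (W : Finset ℤ)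
    (hW : ∀ x : ℤ, |x| ≤ |c| * d → x ∈ W) :
    ∑ x ∈ W.filter (fun x : ℤ => (x : ZMod d) = i),
      (((if x - c * d ≤ 0 then 1 else 0) - (if x ≤ 0 then 1 else 0) : ℤ)) = c := by
  have hd' : (0 : ℤ) < d := by exact_mod_cast hd
  -- an interval of `b` periods contains `b` elements of the class `i`
  have key : ∀ a b : ℤ, 0 ≤ b → Finset.Ioc (a * d) ((a + b) * d) ⊆ W →
      ∑ x ∈ W.filter (fun x : ℤ => (x : ZMod d) = i),
        ((if x ∈ Finset.Ioc (a * d) ((a + b) * d) then 1 else 0 : ℤ)) = b := by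
    intro a b hb hsub
    rw [Finset.sum_boole, Finset.filter_comm, Finset.filter_mem_eq_inter,
      Finset.inter_eq_right.2 hsub]
    obtain ⟨v, rfl⟩ := ZMod.intCast_surjective i
    simp only [ZMod.intCast_eq_intCast_iff]
    have e : ∀ t : ℤ, ⌊((t * d - v : ℤ) : ℚ) / (d : ℤ)⌋ = t + ⌊((-v : ℤ) : ℚ) / (d : ℤ)⌋ := by
      intro t
      rw [← Int.floor_intCast_add]
      congr 1
      have : ((d : ℤ) : ℚ) ≠ 0 := by exact_mod_cast hd'.ne'
      push_cast at this ⊢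
      field_simp
      ring
    have e1 := e a
    have e2 := e (a + b)
    rw [Int.Ioc_filter_modEq_card _ _ hd']
    push_cast at e1 e2 ⊢
    rw [e1, e2]
    omega
  rcases le_total 0 c with h0 | h0
  · have hc : 0 ≤ c * d := by positivity
    refine Eq.trans ?_ (key 0 c h0 ?_)
    · refine Finset.sum_congr rfl fun x _ => ?_
      simp only [Finset.mem_Ioc, zero_mul, zero_add]
      split_ifs <;> omega
    · intro x hx
      rw [Finset.mem_Ioc, zero_mul, zero_add] at hx
      apply hW
      rw [abs_of_nonneg h0, abs_le]
      omega
  · have hc : c * d ≤ 0 := mul_nonpos_of_nonpos_of_nonneg h0 hd'.le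
    rw [← neg_inj, ← Finset.sum_neg_distrib]
    refine Eq.trans ?_ (key c (-c) (by omega) ?_)
    · refine Finset.sum_congr rfl fun x _ => ?_
      simp only [Finset.mem_Ioc, add_neg_cancel, zero_mul]
      split_ifs <;> omega
    · intro x hx
      simp only [Finset.mem_Ioc, add_neg_cancel, zero_mul] at hx
      apply hW
      rw [abs_of_nonpos h0, abs_le]
      constructor <;> linarith

/-! ### Beads and gaps of a Young diagram -/

namespace YoungDiagram

/-- The bead of the row `r`, in the beta-set normalized to charge zero. -/
def rowBead (Y : YoungDiagram) (r : ℕ) : ℤ := (Y.rowLen r : ℤ) - 1 - r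

/-- The gap of the column `s`, in the beta-set normalized to charge zero. -/
def colGap (Y : YoungDiagram) (s : ℕ) : ℤ := (s : ℤ) - Y.colLen s

theorem mem_iff_colGap_lt_rowBead (Y : YoungDiagram) (r s : ℕ) :
    (r, s) ∈ Y ↔ Y.colGap s < Y.rowBead r := by
  have h1 := Y.mem_iff_lt_rowLen (i := r) (j := s)
  have h2 := Y.mem_iff_lt_colLen (i := r) (j := s)
  unfold colGap rowBead
  by_cases h : (r, s) ∈ Y
  · have := h1.1 h
    have := h2.1 h
    exact iff_of_true h (by omega)
  · have := mt h1.2 h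
    have := mt h2.2 h
    exact iff_of_false h (by omega)

theorem rowBead_strictAnti (Y : YoungDiagram) : StrictAnti Y.rowBead := by
  intro r r' h
  have := Y.rowLen_anti r r' h.le
  unfold rowBead
  omega

theorem colGap_strictMono (Y : YoungDiagram) : StrictMono Y.colGap := by
  intro s s' h
  have := Y.colLen_anti s s' h.le
  unfold colGap
  omega

theorem rowBead_ne_colGap (Y : YoungDiagram) (r s : ℕ) : Y.rowBead r ≠ Y.colGap s := by
  have h1 := Y.mem_iff_lt_rowLen (i := r) (j := s)
  have h2 := Y.mem_iff_lt_colLen (i := r) (j := s)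
  unfold colGap rowBead
  by_cases h : (r, s) ∈ Y
  · have := h1.1 h
    have := h2.1 h
    omega
  · have := mt h1.2 h
    have := mt h2.2 h
    omega

/-- Every integer is a bead or a gap. -/
theorem exists_rowBead_or_colGap (Y : YoungDiagram) (n : ℤ) :
    (∃ r, Y.rowBead r = n) ∨ ∃ s, Y.colGap s = n := by
  have hex : ∃ r, Y.rowBead r ≤ n := by
    refine ⟨Y.rowLen 0 + n.natAbs, ?_⟩
    have := Y.rowLen_anti 0 (Y.rowLen 0 + n.natAbs) (Nat.zero_le _)
    unfold rowBead
    omega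
  classical
  have hr := Nat.find_spec hex
  rcases hr.eq_or_lt with h | h
  · exact Or.inl ⟨_, h⟩
  right
  -- the gap `n` lies between the beads of the rows `r - 1` and `r`, hence in the column `n + r`
  generalize hrdef : Nat.find hex = r at *
  have h0 : 0 ≤ n + r := by
    unfold rowBead at h
    omega
  refine ⟨(n + r).toNat, ?_⟩
  suffices hcol : Y.colLen (n + r).toNat = r by
    unfold colGap
    omega
  have hnot : (r, (n + r).toNat) ∉ Y := by
    rw [mem_iff_lt_rowLen]
    unfold rowBead at h
    omega
  rw [mem_iff_lt_colLen, not_lt] at hnot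
  refine le_antisymm hnot ?_
  rcases Nat.eq_zero_or_pos r with h0 | h0
  · omega
  have hlt : n < Y.rowBead (r - 1) := by
    by_contra hcon
    exact Nat.find_min hex (m := r - 1) (by omega) (by omega)
  have : (r - 1, (n + r).toNat) ∈ Y := by
    rw [mem_iff_lt_rowLen]
    unfold rowBead at hlt
    omega
  rw [mem_iff_lt_colLen] at this
  omega

theorem exists_colGap_iff (Y : YoungDiagram) (n : ℤ) :
    (∃ s, Y.colGap s = n) ↔ ¬ ∃ r, Y.rowBead r = n := by
  constructor
  · rintro ⟨s, rfl⟩ ⟨r, hr⟩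
    exact Y.rowBead_ne_colGap r s hr
  · exact (Y.exists_rowBead_or_colGap n).resolve_left

theorem hookLen_eq (Y : YoungDiagram) (z : ℕ × ℕ) :
    Y.hookLen z = Y.rowBead z.1 - Y.colGap z.2 := by
  unfold hookLen rowBead colGap
  ring

theorem handResidue_eq (Y : YoungDiagram) (d : ℕ) {z : ℕ × ℕ} (hz : z ∈ Y) :
    Y.handResidue d z = (Y.rowBead z.1 : ZMod d) := by
  have h : 0 < Y.rowLen z.1 := by
    have := Y.mem_iff_lt_rowLen.1 (show (z.1, z.2) ∈ Y from hz)
    omega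
  simp only [handResidue, nodeResidue, rowBead]
  push_cast [Nat.cast_sub h]
  ring

theorem footResidue_sub_one_eq (Y : YoungDiagram) (d : ℕ) {z : ℕ × ℕ} (hz : z ∈ Y) :
    Y.footResidue d z - 1 = (Y.colGap z.2 : ZMod d) := by
  have h : 0 < Y.colLen z.2 := by
    have := Y.mem_iff_lt_colLen.1 (show (z.1, z.2) ∈ Y from hz)
    omega
  simp only [footResidue, nodeResidue, colGap]
  push_cast [Nat.cast_sub h]
  ring

theorem rowBead_of_colLen_le (Y : YoungDiagram) {r : ℕ} (h : Y.colLen 0 ≤ r) :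
    Y.rowBead r = -1 - r := by
  have h0 : (r, 0) ∉ Y := by
    rw [mem_iff_lt_colLen]
    omega
  rw [mem_iff_lt_rowLen] at h0
  unfold rowBead
  omega

theorem mem_betaSet (Y : YoungDiagram) {N : ℕ} (hN : Y.colLen 0 ≤ N) (b : ℕ) :
    b ∈ Y.betaSet N ↔ ∃ r, Y.rowBead r = (b : ℤ) - N := by
  simp only [betaSet, Finset.mem_image, Finset.mem_range]
  constructor
  · rintro ⟨r, hr, rfl⟩
    refine ⟨r, ?_⟩
    unfold rowBead
    omega
  · rintro ⟨r, hr⟩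
    have hrN : r < N := by
      by_contra hcon
      rw [Y.rowBead_of_colLen_le (by omega)] at hr
      omega
    refine ⟨r, hrN, ?_⟩
    unfold rowBead at hr
    omega

theorem exists_rowBead_of_lt (Y : YoungDiagram) {n : ℤ} (h : n < -(Y.colLen 0 : ℤ)) :
    ∃ r, Y.rowBead r = n := by
  refine ⟨(-1 - n).toNat, ?_⟩
  rw [Y.rowBead_of_colLen_le (by omega)]
  omega

end YoungDiagram

namespace BarPartition

/-! ### The doubled partition and its Maya diagram -/

variable (l : BarPartition)

theorem idx_injOn : Set.InjOn l.idx l.parts := by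
  intro a ha b hb hab
  rcases lt_trichotomy a b with h | h | h
  · exact absurd (l.idx_lt_idx hb h) (by omega)
  · exact h
  · exact absurd (l.idx_lt_idx ha h) (by omega)

theorem mem_doubling (i j : ℕ) : (i, j) ∈ l.doubling ↔ ∃ a ∈ l.parts,
    (i = l.idx a ∧ i ≤ j ∧ j ≤ i + a) ∨ (j = l.idx a ∧ j ≤ i ∧ i < j + a) :=
  l.mem_doublingCells i j

theorem rowBead_idx {a : ℕ} (ha : a ∈ l.parts) : l.doubling.rowBead (l.idx a) = a := by
  have h1 : (l.idx a, l.idx a + a) ∈ l.doubling :=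
    (l.mem_doubling _ _).2 ⟨a, ha, Or.inl ⟨rfl, by omega, le_rfl⟩⟩
  have h2 : (l.idx a, l.idx a + a + 1) ∉ l.doubling := by
    rw [mem_doubling]
    rintro ⟨b, hb, ⟨h, -, h'⟩ | ⟨-, h, -⟩⟩
    · have := l.idx_injOn ha hb h
      omega
    · omega
  rw [YoungDiagram.mem_iff_lt_rowLen] at h1 h2
  unfold YoungDiagram.rowBead
  omega

theorem colGap_idx {a : ℕ} (ha : a ∈ l.parts) : l.doubling.colGap (l.idx a) = -a := by
  have hpos := l.pos a ha
  have h1 : (l.idx a + a - 1, l.idx a) ∈ l.doubling :=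
    (l.mem_doubling _ _).2 ⟨a, ha, Or.inr ⟨rfl, by omega, by omega⟩⟩
  have h2 : (l.idx a + a, l.idx a) ∉ l.doubling := by
    rw [mem_doubling]
    rintro ⟨b, hb, ⟨-, h, -⟩ | ⟨h, -, h'⟩⟩
    · omega
    · have := l.idx_injOn ha hb h
      omega
  rw [YoungDiagram.mem_iff_lt_colLen] at h1 h2
  unfold YoungDiagram.colGap
  omega

theorem card_card_notMem_doubling : (l.parts.card, l.parts.card) ∉ l.doubling := by
  rw [mem_doubling]
  rintro ⟨a, ha, ⟨h, -, -⟩ | ⟨h, -, -⟩⟩ <;>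
  · have := l.idx_lt_card ha
    omega

theorem rowBead_neg {r : ℕ} (h : l.parts.card ≤ r) : l.doubling.rowBead r < 0 := by
  have h1 := l.card_card_notMem_doubling
  rw [YoungDiagram.mem_iff_lt_rowLen] at h1
  have := l.doubling.rowLen_anti _ _ h
  unfold YoungDiagram.rowBead
  omega

theorem colGap_nonneg {s : ℕ} (h : l.parts.card ≤ s) : 0 ≤ l.doubling.colGap s := by
  have h1 := l.card_card_notMem_doubling
  rw [YoungDiagram.mem_iff_lt_colLen] at h1
  have := l.doubling.colLen_anti _ _ h
  unfold YoungDiagram.colGap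
  omega

/-- The beads of the doubled partition are the nonzero elements of the Maya diagram. -/
theorem exists_rowBead_iff (n : ℤ) :
    (∃ r, l.doubling.rowBead r = n) ↔ n ≠ 0 ∧ n ∈ l.maya := by
  have hpos : ∀ r, 0 ≤ l.doubling.rowBead r →
      ∃ a ∈ l.parts, (a : ℤ) = l.doubling.rowBead r := by
    intro r hr
    have hlt : r < l.parts.card := by
      by_contra hcon
      have := l.rowBead_neg (not_lt.1 hcon)
      omega
    obtain ⟨a, ha, rfl⟩ := l.exists_idx_eq hlt
    exact ⟨a, ha, (l.rowBead_idx ha).symm⟩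
  rcases lt_trichotomy n 0 with h | rfl | h
  · rw [mem_maya_of_nonpos h.le, ← not_iff_not, ← YoungDiagram.exists_colGap_iff]
    simp only [ne_eq, h.ne, not_false_eq_true, true_and, not_not]
    constructor
    · rintro ⟨s, rfl⟩
      have hlt : s < l.parts.card := by
        by_contra hcon
        have := l.colGap_nonneg (not_lt.1 hcon)
        omega
      obtain ⟨a, ha, rfl⟩ := l.exists_idx_eq hlt
      rwa [l.colGap_idx ha, Int.natAbs_neg, Int.natAbs_natCast]
    · intro hn
      exact ⟨_, (l.colGap_idx hn).trans (by omega)⟩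
  · refine iff_of_false ?_ (by simp)
    rintro ⟨r, hr⟩
    obtain ⟨a, ha, hr'⟩ := hpos r hr.ge
    have := l.pos a ha
    omega
  · rw [mem_maya_of_pos h]
    constructor
    · rintro ⟨r, rfl⟩
      obtain ⟨a, ha, hr⟩ := hpos r h.le
      rw [← hr, Int.natAbs_natCast]
      exact ⟨by omega, ha⟩
    · rintro ⟨-, hn⟩
      exact ⟨_, (l.rowBead_idx hn).trans (by omega)⟩

theorem rowBead_mem_maya (r : ℕ) : l.doubling.rowBead r ∈ l.maya :=
  ((l.exists_rowBead_iff _).1 ⟨r, rfl⟩).2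

/-- The gaps of the doubled partition are the negatives of the elements of the Maya diagram. -/
theorem exists_colGap_iff (n : ℤ) :
    (∃ s, l.doubling.colGap s = -n) ↔ n ∈ l.maya := by
  rw [YoungDiagram.exists_colGap_iff, exists_rowBead_iff]
  rcases eq_or_ne n 0 with rfl | h
  · simp [zero_mem_maya]
  · simp [h, neg_mem_maya]

/-- A cell of the doubled partition lies to the right of the diagonal when its row bead exceeds the
negative of its column gap: on the diagonal the two are equal. -/
theorem lt_iff_pos_rowBead_add_colGap {r s : ℕ} (h : (r, s) ∈ l.doubling) :
    r < s ↔ 0 < l.doubling.rowBead r + l.doubling.colGap s := by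
  rw [YoungDiagram.mem_iff_colGap_lt_rowBead] at h
  have hdiag : ∀ k < l.parts.card, l.doubling.rowBead k = -l.doubling.colGap k := by
    intro k hk
    obtain ⟨a, ha, rfl⟩ := l.exists_idx_eq hk
    rw [l.rowBead_idx ha, l.colGap_idx ha, neg_neg]
  rcases lt_or_ge r l.parts.card with hr | hr
  · rw [hdiag r hr, neg_add_eq_sub, sub_pos, l.doubling.colGap_strictMono.lt_iff_lt]
  · have hneg := l.rowBead_neg hr
    have hs : s < l.parts.card := by
      by_contra hcon
      have := l.colGap_nonneg (not_lt.1 hcon)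
      omega
    have hds := hdiag s hs
    have := l.doubling.rowBead_strictAnti (hs.trans_le hr)
    exact iff_of_false (by omega) (by omega)

theorem colGap_card : l.doubling.colGap l.parts.card = 0 := by
  have h0 := (l.exists_colGap_iff 0).2 l.zero_mem_maya
  obtain ⟨s, hs⟩ := h0
  rw [neg_zero] at hs
  have hle : l.parts.card ≤ s := by
    by_contra hcon
    obtain ⟨a, ha, rfl⟩ := l.exists_idx_eq (not_le.1 hcon)
    have := l.pos a ha
    have := l.colGap_idx ha
    omega
  have := l.doubling.colGap_strictMono.monotone hle
  have := l.colGap_nonneg le_rfl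
  omega

theorem mem_partCells {z : ℕ × ℕ} :
    z ∈ l.partCells ↔ z.2 = l.parts.card ∧ 0 < l.doubling.rowBead z.1 := by
  obtain ⟨r, s⟩ := z
  simp only [partCells, Finset.mem_filter, YoungDiagram.mem_cells,
    YoungDiagram.mem_iff_colGap_lt_rowBead]
  constructor
  · rintro ⟨h, rfl⟩
    rw [colGap_card] at h
    exact ⟨rfl, h⟩
  · rintro ⟨rfl, h⟩
    rw [colGap_card]
    exact ⟨h, rfl⟩

theorem partCells_subset_shiftedCells : l.partCells ⊆ l.shiftedCells := by
  intro z hz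
  have hz' := (l.mem_partCells).1 hz
  have hmem : z ∈ l.doubling := (Finset.mem_filter.1 hz).1
  refine Finset.mem_filter.2 ⟨hmem, ?_⟩
  rw [l.lt_iff_pos_rowBead_add_colGap hmem, hz'.1, colGap_card]
  omega

/-- The bars, as pairs of distinct elements of the Maya diagram with positive sum, the larger
element first. -/
noncomputable def barPairs : Finset (ℤ × ℤ) :=
  (Finset.Icc (-(l.bound : ℤ)) l.bound ×ˢ Finset.Icc (-(l.bound : ℤ)) l.bound).filter fun p =>
    p.1 ∈ l.maya ∧ p.2 ∈ l.maya ∧ p.2 < p.1 ∧ 0 < p.1 + p.2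

variable {l} in
theorem mem_barPairs {p : ℤ × ℤ} :
    p ∈ l.barPairs ↔ p.1 ∈ l.maya ∧ p.2 ∈ l.maya ∧ p.2 < p.1 ∧ 0 < p.1 + p.2 := by
  simp only [barPairs, Finset.mem_filter, Finset.mem_product, Finset.mem_Icc,
    and_iff_right_iff_imp]
  rintro ⟨h1, h2, h3, h4⟩
  have := le_bound_of_mem_maya h1
  omega

/-- The cells of the shifted diagram correspond to the bars: the bead of the row is paired with
the negative of the gap of the column. -/
theorem map_shiftedCells {β : Type*} (f : ℤ × ℤ → β) :
    l.shiftedCells.val.map (fun z => f (l.doubling.rowBead z.1, -l.doubling.colGap z.2)) =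
      l.barPairs.val.map f := by
  have himg : l.barPairs =
      l.shiftedCells.image fun z => (l.doubling.rowBead z.1, -l.doubling.colGap z.2) := by
    ext ⟨x, z⟩
    rw [mem_barPairs]
    simp only [Finset.mem_image, shiftedCells, Finset.mem_filter, YoungDiagram.mem_cells,
      Prod.mk.injEq, Prod.exists]
    constructor
    · rintro ⟨hx, hz, hlt, hpos⟩
      obtain ⟨r, rfl⟩ := (l.exists_rowBead_iff x).2 ⟨by omega, hx⟩
      obtain ⟨s, hs⟩ := (l.exists_colGap_iff z).2 hz
      have hmem : (r, s) ∈ l.doubling := by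
        rw [YoungDiagram.mem_iff_colGap_lt_rowBead]
        omega
      exact ⟨r, s, ⟨hmem, (l.lt_iff_pos_rowBead_add_colGap hmem).2 (by omega)⟩, rfl, by omega⟩
    · rintro ⟨r, s, ⟨hmem, hlt⟩, rfl, rfl⟩
      have h1 := (l.lt_iff_pos_rowBead_add_colGap hmem).1 hlt
      rw [YoungDiagram.mem_iff_colGap_lt_rowBead] at hmem
      exact ⟨l.rowBead_mem_maya r, (l.exists_colGap_iff _).1 ⟨s, (neg_neg _).symm⟩,
        by omega, by omega⟩
  rw [himg, Finset.image_val_of_injOn, Multiset.map_map]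
  · rfl
  · rintro ⟨r, s⟩ - ⟨r', s'⟩ - h
    simp only [Prod.mk.injEq, neg_inj] at h
    rw [l.doubling.rowBead_strictAnti.injective h.1, l.doubling.colGap_strictMono.injective h.2]

/-- The cells in the first column after the diagonal correspond to the parts. -/
theorem exists_mem_partCells_iff (x : ℤ) :
    (∃ z ∈ l.partCells, l.doubling.rowBead z.1 = x) ↔ 0 < x ∧ x ∈ l.maya := by
  constructor
  · rintro ⟨z, hz, rfl⟩
    exact ⟨((l.mem_partCells).1 hz).2, l.rowBead_mem_maya _⟩
  · rintro ⟨h, hx⟩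
    obtain ⟨r, rfl⟩ := (l.exists_rowBead_iff x).2 ⟨h.ne', hx⟩
    exact ⟨(r, _), (l.mem_partCells).2 ⟨rfl, h⟩, rfl⟩

/-! ### Bar lengths as sums over the Maya diagram -/

theorem count_barLengths_summand (l : BarPartition) {a : ℕ} (ha : a ∈ l.parts) (k : ℕ) :
    ((Finset.Icc 1 a).val + (l.parts.filter (· < a)).val.map (fun b => a + b)
      - (l.parts.filter (· < a)).val.map (fun b => a - b)).count k =
    if ((a : ℤ), (k : ℤ) - a) ∈ l.barPairs then 1 else 0 := by
  have h1 : ((l.parts.filter (· < a)).val.map (fun b => a + b)).Nodup :=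
    Multiset.Nodup.map (fun _ _ h => Nat.add_left_cancel h) (Finset.nodup _)
  have h2 : ((l.parts.filter (· < a)).val.map (fun b => a - b)).Nodup := by
    refine Multiset.Nodup.map_on (fun b hb c hc h => ?_) (Finset.nodup _)
    rw [Finset.mem_val, Finset.mem_filter] at hb hc
    omega
  have e1 : k ∈ (l.parts.filter (· < a)).val.map (fun b => a + b) ↔
      a ≤ k ∧ k - a ∈ l.parts ∧ k - a < a := by
    simp only [Multiset.mem_map, Finset.mem_val, Finset.mem_filter]
    constructor
    · rintro ⟨b, ⟨hb, hba⟩, rfl⟩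
      rw [Nat.add_sub_cancel_left]
      exact ⟨by omega, hb, hba⟩
    · rintro ⟨h, hb, hba⟩
      exact ⟨k - a, ⟨hb, hba⟩, by omega⟩
  have e2 : k ∈ (l.parts.filter (· < a)).val.map (fun b => a - b) ↔
      0 < k ∧ k < a ∧ a - k ∈ l.parts := by
    simp only [Multiset.mem_map, Finset.mem_val, Finset.mem_filter]
    constructor
    · rintro ⟨b, ⟨hb, hba⟩, rfl⟩
      have := l.pos b hb
      rw [Nat.sub_sub_self hba.le]
      exact ⟨by omega, by omega, hb⟩
    · rintro ⟨h0, h, hb⟩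
      exact ⟨a - k, ⟨hb, by omega⟩, by omega⟩
  rw [Multiset.count_sub, Multiset.count_add, Multiset.count_eq_of_nodup h1,
    Multiset.count_eq_of_nodup h2, Multiset.count_eq_of_nodup (Finset.nodup _)]
  simp only [e1, e2, Finset.mem_val, Finset.mem_Icc, mem_barPairs]
  have hpos := l.pos a ha
  have hma : (a : ℤ) ∈ l.maya := (natCast_mem_maya hpos).2 ha
  simp only [hma, true_and]
  rcases lt_trichotomy k a with h | rfl | h
  · have hm : (k : ℤ) - a ∈ l.maya ↔ a - k ∉ l.parts := by
      rw [mem_maya_of_nonpos (by omega)]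
      have : ((k : ℤ) - a).natAbs = a - k := by omega
      rw [this]
    by_cases h' : a - k ∈ l.parts <;>
      simp only [hm, h', not_true, not_false_eq_true, true_and, and_true, false_and, and_false,
        if_false] <;>
      split_ifs <;> omega
  · have h3 : 1 ≤ k := hpos
    simp [l.zero_mem_maya, l.zero_notMem_parts, h3, hpos.ne']
  · have hm : (k : ℤ) - a ∈ l.maya ↔ k - a ∈ l.parts := by
      rw [mem_maya_of_pos (by omega)]
      have : ((k : ℤ) - a).natAbs = k - a := by omega
      rw [this]
    by_cases h' : k - a ∈ l.parts <;>
      simp only [hm, h', true_and, false_and, and_false, if_false] <;> split_ifs <;> omega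

theorem barLengths_eq (l : BarPartition) :
    l.barLengths = l.barPairs.val.map fun p => (p.1 + p.2).natAbs := by
  ext k
  rw [barLengths, Multiset.count_sum', Finset.sum_congr rfl
    (fun a ha => l.count_barLengths_summand ha k), ← Finset.card_filter, Multiset.count_map]
  change _ = (l.barPairs.filter fun p : ℤ × ℤ => k = (p.1 + p.2).natAbs).card
  refine Finset.card_bij (fun a _ => ((a : ℤ), (k : ℤ) - a)) ?_ ?_ ?_
  · intro a ha
    rw [Finset.mem_filter] at ha
    refine Finset.mem_filter.2 ⟨ha.2, ?_⟩
    simp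
  · intro a _ b _ h
    simpa using (Prod.ext_iff.1 h).1
  · rintro ⟨x, z⟩ hp
    obtain ⟨hp, hk⟩ := Finset.mem_filter.1 hp
    have hp' := mem_barPairs.1 hp
    simp only at hp' hk
    have hx : ((x.natAbs : ℕ) : ℤ) = x := by omega
    have hz : (k : ℤ) - x = z := by omega
    refine ⟨x.natAbs, Finset.mem_filter.2 ⟨(mem_maya_of_pos (by omega)).1 hp'.1, ?_⟩, ?_⟩
    · rwa [hx, hz]
    · rw [hx, hz]

theorem mem_barLengths {l : BarPartition} {k : ℕ} :
    k ∈ l.barLengths ↔ 0 < k ∧ ∃ x ∈ l.maya, ∃ z ∈ l.maya, x ≠ z ∧ x + z = k := by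
  simp only [barLengths_eq, Multiset.mem_map, Finset.mem_val, Prod.exists, mem_barPairs]
  constructor
  · rintro ⟨x, z, ⟨hx, hz, hlt, hpos⟩, rfl⟩
    exact ⟨by omega, x, hx, z, hz, hlt.ne', by omega⟩
  · rintro ⟨hk, x, hx, z, hz, hne, hs⟩
    rcases lt_or_gt_of_ne hne with h | h
    · exact ⟨z, x, ⟨hz, hx, h, by omega⟩, by omega⟩
    · exact ⟨x, z, ⟨hx, hz, h, by omega⟩, by omega⟩

/-! ### The bar core -/

theorem exists_barRemoval {l : BarPartition} {k : ℕ} (hk : k ∈ l.barLengths) :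
    ∃ m, BarRemoval k l m := by
  rw [barLengths_eq, Multiset.mem_map] at hk
  obtain ⟨⟨x, z⟩, hp, rfl⟩ := hk
  obtain ⟨hx, hz, hlt, hpos⟩ := mem_barPairs.1 hp
  simp only at hx hz hlt hpos ⊢
  rw [mem_maya_of_pos (by omega)] at hx
  rcases lt_trichotomy z 0 with h | rfl | h
  · rw [mem_maya_of_nonpos h.le] at hz
    have e : x.natAbs - (x + z).natAbs = z.natAbs := by omega
    refine ⟨⟨insert z.natAbs (l.parts.erase x.natAbs), fun a ha => ?_⟩,
      Or.inl ⟨x.natAbs, hx, by omega, by omega, by rwa [e], by rw [e]⟩⟩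
    rcases Finset.mem_insert.1 ha with rfl | ha
    · omega
    · exact l.pos a (Finset.mem_of_mem_erase ha)
  · rw [add_zero]
    exact ⟨⟨l.parts.erase x.natAbs, fun a ha => l.pos a (Finset.mem_of_mem_erase ha)⟩,
      Or.inr (Or.inl ⟨hx, rfl⟩)⟩
  · rw [mem_maya_of_pos h] at hz
    exact ⟨⟨(l.parts.erase x.natAbs).erase z.natAbs, fun a ha =>
      l.pos a (Finset.mem_of_mem_erase (Finset.mem_of_mem_erase ha))⟩,
      Or.inr (Or.inr ⟨_, hx, _, hz, by omega, by omega, rfl⟩)⟩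

theorem BarRemoval.sum_lt {k : ℕ} {l m : BarPartition} (h : BarRemoval k l m) :
    ∑ a ∈ m.parts, a < ∑ a ∈ l.parts, a := by
  rcases h with ⟨a, ha, hk, hka, hn, hm⟩ | ⟨hk, hm⟩ | ⟨a, ha, b, hb, hba, -, hm⟩
  · rw [hm, Finset.sum_insert (fun h => hn (Finset.mem_of_mem_erase h)),
      ← Finset.add_sum_erase _ _ ha]
    omega
  · have := l.pos k hk
    rw [hm, ← Finset.add_sum_erase _ _ hk]
    omega
  · have := l.pos a ha
    have hb' : b ∈ l.parts.erase a := Finset.mem_erase.2 ⟨hba.ne, hb⟩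
    rw [hm, ← Finset.add_sum_erase _ _ ha, ← Finset.add_sum_erase _ _ hb']
    omega

/-- The charges are unchanged when a bar of length divisible by `d` is removed: a part keeps its
residue, or a part in the class `0`, or parts in opposite classes, disappear. -/
theorem BarRemoval.charge_eq {d k : ℕ} (hk : d ∣ k) {l m : BarPartition} (h : BarRemoval k l m)
    (i : ZMod d) : m.charge d i = l.charge d i := by
  have hk0 : (k : ZMod d) = 0 := (ZMod.natCast_eq_zero_iff k d).2 hk
  unfold charge
  rcases h with ⟨a, ha, -, hka, hn, hm⟩ | ⟨hk, hm⟩ | ⟨a, ha, b, hb, hba, hs, hm⟩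
  · rw [hm, Finset.sum_insert (fun h => hn (Finset.mem_of_mem_erase h)),
      ← Finset.add_sum_erase _ _ ha, Nat.cast_sub hka.le, hk0, sub_zero]
  · rw [hm, ← Finset.add_sum_erase _ _ hk, hk0]
    simp
  · have hb' : b ∈ l.parts.erase a := Finset.mem_erase.2 ⟨hba.ne, hb⟩
    have e : (b : ZMod d) = -a := by
      rw [eq_neg_iff_add_eq_zero, add_comm, ← Nat.cast_add, hs, hk0]
    rw [hm, ← Finset.add_sum_erase _ _ ha, ← Finset.add_sum_erase _ _ hb', e, neg_neg]
    ring

theorem exists_isBarCore (d : ℕ) (l : BarPartition) : ∃ c, IsBarCore d l c := by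
  induction hn : ∑ a ∈ l.parts, a using Nat.strong_induction_on generalizing l with
  | _ n ih =>
    by_cases h : ∀ k ∈ l.barLengths, ¬ d ∣ k
    · exact ⟨l, Relation.ReflTransGen.refl, h⟩
    · push Not at h
      obtain ⟨k, hk, hdk⟩ := h
      obtain ⟨m, hm⟩ := exists_barRemoval hk
      obtain ⟨c, hc, hc'⟩ := ih _ (hn ▸ hm.sum_lt) m rfl
      exact ⟨c, Relation.ReflTransGen.head ⟨k, hdk, hm⟩ hc, hc'⟩

theorem IsBarCore.charge_eq {d : ℕ} {l c : BarPartition} (h : IsBarCore d l c) :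
    c.charge d = l.charge d := by
  obtain ⟨h, -⟩ := h
  induction h with
  | refl => rfl
  | tail _ h2 ih =>
    obtain ⟨k, hk, h2⟩ := h2
    exact (funext fun i => h2.charge_eq hk i).trans ih

/-- The Maya diagram of a bar core is filled up to the level given by the charges: as `d` is odd,
the pair `x, d - x` of elements with sum `d` is never degenerate, so that the diagram is closed
under subtraction of `d`. -/
theorem IsBarCore.mem_maya_iff {d : ℕ} (hd : Odd d) {l c : BarPartition} (h : IsBarCore d l c)
    (x : ℤ) : x ∈ c.maya ↔ slide d (-l.charge d) x ≤ 0 := by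
  have hd0 : 0 < d := hd.pos
  have hd0' : (0 : ℤ) < d := by exact_mod_cast hd0
  -- closure under subtraction of `d`
  have hstep : ∀ y ∈ c.maya, y - d ∈ c.maya := by
    intro y hy
    by_contra hcon
    rcases eq_or_ne (y - d) 0 with h0 | h0
    · exact hcon (h0 ▸ c.zero_mem_maya)
    rw [← neg_mem_maya h0] at hcon
    refine h.2 d (mem_barLengths.2 ⟨hd0, y, hy, _, hcon, ?_, by ring⟩) dvd_rfl
    obtain ⟨t, ht⟩ := hd
    omega
  have hsteps : ∀ n : ℕ, ∀ y ∈ c.maya, y - n * d ∈ c.maya := by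
    intro n
    induction n with
    | zero => simp
    | succ n ih =>
      intro y hy
      have := hstep _ (ih y hy)
      convert this using 1
      push_cast
      ring
  have hdown : ∀ y ∈ c.maya, ∀ y' : ℤ, (y' : ZMod d) = y → y' ≤ y → y' ∈ c.maya := by
    intro y hy y' hyy hle
    obtain ⟨n, hn⟩ := (ZMod.intCast_eq_intCast_iff_dvd_sub y' y d).1 hyy
    have hn0 : 0 ≤ n := by
      by_contra hcon
      nlinarith
    have := hsteps n.toNat y hy
    rw [Int.toNat_of_nonneg hn0] at this
    convert this using 1
    linarith
  -- in each class both sets are initial segments with the same relative number of elements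
  set e := l.charge d (x : ZMod d) with he
  have hslide : slide d (-l.charge d) x = x - e * d := by
    rw [slide, Pi.neg_apply]
    ring
  rw [hslide]
  set W : Finset ℤ := Finset.Icc (-(c.bound + |e| * d + |x|)) (c.bound + |e| * d + |x|) with hW
  have hed : 0 ≤ |e| * d := by positivity
  have habs := abs_nonneg x
  have h1 := charge_eq_sum d c (x : ZMod d) W (by
    intro y hy
    have := le_bound hy
    rw [hW, Finset.mem_Icc]
    omega)
  have h2 := sum_shifted_halfLine hd0 e (x : ZMod d) W (by
    intro y hy
    rw [abs_le] at hy
    rw [hW, Finset.mem_Icc]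
    omega)
  rw [h.charge_eq, ← he] at h1
  have h3 : ∑ y ∈ W.filter (fun y : ℤ => (y : ZMod d) = x),
      (((if y ∈ c.maya then 1 else 0) - (if y - e * d ≤ 0 then 1 else 0) : ℤ)) = 0 := by
    refine Eq.trans ?_ (sub_eq_zero.2 (h1.trans h2.symm))
    rw [← Finset.sum_sub_distrib]
    exact Finset.sum_congr rfl fun y _ => by ring
  have hxW : x ∈ W.filter (fun y : ℤ => (y : ZMod d) = x) := by
    refine Finset.mem_filter.2 ⟨?_, rfl⟩
    rw [hW, Finset.mem_Icc]
    have := neg_abs_le x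
    have := le_abs_self x
    omega
  by_contra hne
  rw [not_iff] at hne
  by_cases hx : x ∈ c.maya
  · have hx' : ¬ x - e * d ≤ 0 := fun h => (hne.2 h) hx
    refine (Finset.sum_pos' (fun y hy => ?_) ⟨x, hxW, ?_⟩).ne' h3
    · by_cases hy' : y - e * d ≤ 0
      · have := hdown x hx y (Finset.mem_filter.1 hy).2 (by omega)
        simp [this, hy']
      · split_ifs <;> simp
    · simp [hx, hx']
  · have hx' : x - e * d ≤ 0 := hne.1 hx
    refine (Finset.sum_neg' (fun y hy => ?_) ⟨x, hxW, ?_⟩).ne h3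
    · by_cases hy' : y ∈ c.maya
      · have : y < x := by
          by_contra hcon
          exact hx (hdown y hy' x (Finset.mem_filter.1 hy).2.symm (not_lt.1 hcon))
        have : y - e * d ≤ 0 := by omega
        simp [this, hy']
      · split_ifs <;> simp
    · simp [hx, hx']

theorem existsUnique_isBarCore {d : ℕ} (hd : Odd d) (l : BarPartition) :
    ∃! c, IsBarCore d l c := by
  obtain ⟨c, hc⟩ := exists_isBarCore d l
  refine ⟨c, hc, fun c' hc' => eq_of_maya_eq fun x => ?_⟩
  rw [hc.mem_maya_iff hd, hc'.mem_maya_iff hd]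

theorem isBarCore_empty_iff {d : ℕ} (hd : Odd d) (q : BarPartition) :
    IsBarCore d q empty ↔ q.charge d = 0 := by
  constructor
  · intro h
    rw [← h.charge_eq]
    rfl
  · intro h
    obtain ⟨c, hc⟩ := exists_isBarCore d q
    have : c = empty := eq_of_maya_eq fun x => by
      rw [hc.mem_maya_iff hd, h]
      simp [slide, mem_maya, empty]
    exact this ▸ hc

end BarPartition

/-! ### Partitions and their beta-sets -/

namespace YoungDiagram

/-- The extension of a beta-set by all negative integers, shifted to charge zero. It is the part
of a beta-set that determines the partition and is determined by it. -/
def betaMaya (X : Finset ℕ) : Set ℤ :=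
  {v | v + X.card < 0 ∨ (v + X.card).toNat ∈ X}

/-- The number of empty positions below `b`. -/
def gapsBelow (X : Finset ℕ) (b : ℕ) : ℕ := ((Finset.range b).filter (· ∉ X)).card

theorem gapsBelow_mono (X : Finset ℕ) : Monotone (gapsBelow X) := fun _ _ h =>
  Finset.card_le_card (Finset.filter_subset_filter _ (Finset.range_mono h))

theorem gapsBelow_succ {X : Finset ℕ} {v : ℕ} (hv : v ∉ X) :
    gapsBelow X (v + 1) = gapsBelow X v + 1 := by
  rw [gapsBelow, Finset.range_add_one, Finset.filter_insert, if_pos hv,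
    Finset.card_insert_of_notMem (by simp)]
  rfl

theorem card_filter_lt_partitionOfBeta (X : Finset ℕ) (j : ℕ) :
    ((partitionOfBeta X).filter (j < ·)).card = (X.filter (j < gapsBelow X ·)).card := by
  have h : (partitionOfBeta X).filter (j < ·) = (X.val.map (gapsBelow X)).filter (j < ·) := by
    rw [partitionOfBeta, Multiset.filter_filter]
    exact Multiset.filter_congr fun x _ => by omega
  rw [h, Multiset.filter_map, Multiset.card_map]
  rfl

theorem eq_of_notMem {X : Finset ℕ} {v : ℕ} (hv : v ∉ X) :
    (v : ℤ) = X.card + gapsBelow X v -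
      ((partitionOfBeta X).filter (gapsBelow X v < ·)).card := by
  have h1 : X.filter (gapsBelow X v < gapsBelow X ·) = X.filter (v < ·) := by
    refine Finset.filter_congr fun b hb => ?_
    constructor
    · intro h
      by_contra hcon
      exact h.not_ge (gapsBelow_mono X (not_lt.1 hcon))
    · intro h
      have := gapsBelow_mono X (Nat.succ_le_of_lt h)
      rw [Nat.succ_eq_add_one, gapsBelow_succ hv] at this
      omega
  have h2 : X.filter (¬ v < ·) = (Finset.range v).filter (· ∈ X) := by
    ext b
    simp only [Finset.mem_filter, Finset.mem_range, not_lt]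
    constructor
    · rintro ⟨hb, hle⟩
      exact ⟨lt_of_le_of_ne hle (fun h => hv (h ▸ hb)), hb⟩
    · rintro ⟨hlt, hb⟩
      exact ⟨hb, hlt.le⟩
  have h3 := Finset.card_filter_add_card_filter_not (s := X) (v < ·)
  have h4 := Finset.card_filter_add_card_filter_not (s := Finset.range v) (· ∈ X)
  rw [h2] at h3
  rw [Finset.card_range] at h4
  rw [card_filter_lt_partitionOfBeta, h1]
  change _ + gapsBelow X v = v at h4
  omega

theorem exists_gapsBelow_eq (X : Finset ℕ) (j : ℕ) : ∃ v, v ∉ X ∧ gapsBelow X v = j := by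
  have hinf : {v | v ∉ X}.Infinite := X.finite_toSet.infinite_compl
  refine ⟨Nat.nth (· ∉ X) j, Nat.nth_mem_of_infinite hinf j, ?_⟩
  rw [gapsBelow, ← Nat.count_eq_card_filter_range, Nat.count_nth_of_infinite hinf]

/-- The `j`-th gap lies `j` steps to the right of the origin, moved back by one step for each part
larger than `j`: the gaps of the Maya diagram depend only on the partition. -/
theorem notMem_betaMaya_iff (X : Finset ℕ) (v : ℤ) :
    v ∉ betaMaya X ↔ ∃ j : ℕ, v = j - ((partitionOfBeta X).filter (j < ·)).card := by
  simp only [betaMaya, Set.mem_ofPred_eq, not_or, not_lt]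
  constructor
  · rintro ⟨h0, h⟩
    have := eq_of_notMem h
    rw [Int.toNat_of_nonneg h0] at this
    exact ⟨gapsBelow X (v + X.card).toNat, by linarith⟩
  · rintro ⟨j, hj⟩
    obtain ⟨w, hw, rfl⟩ := exists_gapsBelow_eq X j
    have := eq_of_notMem hw
    have e : v + X.card = w := by linarith
    rw [e, Int.toNat_natCast]
    exact ⟨by omega, hw⟩

theorem partitionOfBeta_eq_of_le {X Y : Finset ℕ} (hle : X.card ≤ Y.card)
    (h : ∀ v, v ∈ betaMaya X ↔ v ∈ betaMaya Y) : partitionOfBeta X = partitionOfBeta Y := by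
  obtain ⟨t, ht⟩ := Nat.exists_eq_add_of_le hle
  -- `Y` is obtained from `X` by a shift by `t`, with the first `t` positions filled
  have hY : ∀ u, u ∈ Y ↔ u < t ∨ u - t ∈ X := by
    intro u
    have := h ((u : ℤ) - Y.card)
    simp only [betaMaya, Set.mem_ofPred_eq, sub_add_cancel, Int.toNat_natCast] at this
    have e1 : (u : ℤ) - Y.card + X.card < 0 ↔ u < t := by omega
    have e2 : ((u : ℤ) - Y.card + X.card).toNat = u - t := by omega
    rw [e1, e2] at this
    rw [this]
    simp
  have hg : ∀ b, gapsBelow Y (b + t) = gapsBelow X b := by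
    intro b
    refine (congrArg Finset.card ?_).trans (Finset.card_map (addRightEmbedding t))
    ext u
    simp only [Finset.mem_filter, Finset.mem_range, hY, Finset.mem_map, addRightEmbedding_apply,
      not_or, not_lt]
    constructor
    · rintro ⟨h1, h2, h3⟩
      exact ⟨u - t, ⟨by omega, h3⟩, by omega⟩
    · rintro ⟨w, ⟨h1, h2⟩, rfl⟩
      rw [Nat.add_sub_cancel]
      exact ⟨by omega, by omega, h2⟩
  -- only positive parts are counted, so the filled positions of `Y` do not matter
  have hcount : ∀ (Z : Finset ℕ) (k : ℕ), (partitionOfBeta Z).count k =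
      if 0 < k then (Z.filter (fun b => k = gapsBelow Z b)).card else 0 := by
    intro Z k
    rw [partitionOfBeta, Multiset.count_filter, Multiset.count_map]
    rfl
  ext k
  rw [hcount, hcount]
  split_ifs with hk
  · refine Finset.card_bij (fun b _ => b + t) ?_ (fun _ _ _ _ h => Nat.add_right_cancel h) ?_
    · intro b hb
      rw [Finset.mem_filter] at hb ⊢
      rw [hg, hY, Nat.add_sub_cancel]
      exact ⟨Or.inr hb.1, hb.2⟩
    · intro b hb
      rw [Finset.mem_filter, hY] at hb
      have htb : t ≤ b := by
        by_contra hcon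
        have h1 := gapsBelow_mono Y (not_le.1 hcon).le
        have h2 := hg 0
        rw [zero_add] at h2
        have h3 : gapsBelow X 0 = 0 := rfl
        omega
      refine ⟨b - t, ?_, by omega⟩
      rw [Finset.mem_filter, ← hg, Nat.sub_add_cancel htb]
      exact ⟨hb.1.resolve_left (by omega), hb.2⟩
  · rfl

theorem partitionOfBeta_eq_iff (X Y : Finset ℕ) :
    partitionOfBeta X = partitionOfBeta Y ↔ ∀ v, v ∈ betaMaya X ↔ v ∈ betaMaya Y := by
  constructor
  · intro h v
    rw [← not_iff_not, notMem_betaMaya_iff, notMem_betaMaya_iff, h]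
  · intro h
    rcases le_total X.card Y.card with hle | hle
    · exact partitionOfBeta_eq_of_le hle h
    · exact (partitionOfBeta_eq_of_le hle fun v => (h v).symm).symm

end YoungDiagram

namespace BarPartition

/-! ### The abacus of the doubled partition -/

theorem exists_mem_normBetaSet_iff {d : ℕ} (hd : 0 < d) (l : BarPartition) : ∃ n : ℕ,
    l.doubling.colLen 0 ≤ d * n ∧ ∀ b, b ∈ l.doubling.normBetaSet d ↔
      (b : ℤ) - (d * n : ℕ) ≠ 0 ∧ (b : ℤ) - (d * n : ℕ) ∈ l.maya := by
  have hle : l.doubling.colLen 0 ≤ d * ((l.doubling.colLen 0 + d - 1) / d) := by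
    have h1 := Nat.div_add_mod (l.doubling.colLen 0 + d - 1) d
    have h2 := Nat.mod_lt (l.doubling.colLen 0 + d - 1) hd
    omega
  refine ⟨_, hle, fun b => ?_⟩
  rw [YoungDiagram.normBetaSet, YoungDiagram.mem_betaSet _ hle, exists_rowBead_iff]

theorem le_colLen_of_mem_parts (l : BarPartition) {a : ℕ} (ha : a ∈ l.parts) :
    a ≤ l.doubling.colLen 0 := by
  by_contra hcon
  have h1 := (l.exists_rowBead_iff (-a)).1 (l.doubling.exists_rowBead_of_lt (by omega))
  have h2 := l.pos a ha
  rw [neg_mem_maya (by omega), natCast_mem_maya h2] at h1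
  exact h1.2 ha

theorem card_Ico_filter_cast {d : ℕ} (hd : 0 < d) (n : ℕ) (i : ZMod d) :
    (((Finset.Ico (-(d * n : ℕ) : ℤ) 0).filter (fun x : ℤ => (x : ZMod d) = i)).card : ℤ) = n := by
  obtain ⟨v, rfl⟩ := ZMod.intCast_surjective i
  have hd' : (0 : ℤ) < d := by exact_mod_cast hd
  simp only [ZMod.intCast_eq_intCast_iff]
  rw [Int.Ico_filter_modEq_card _ _ hd']
  have e : ⌈((-(d * n : ℕ) - v : ℤ) : ℚ) / (d : ℤ)⌉ =
      -n + ⌈((0 - v : ℤ) : ℚ) / (d : ℤ)⌉ := by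
    rw [← Int.ceil_intCast_add]
    congr 1
    have : ((d : ℤ) : ℚ) ≠ 0 := by exact_mod_cast hd'.ne'
    push_cast at this ⊢
    field_simp
    ring
  push_cast at e ⊢
  rw [e]
  omega

/-- The number of beads on a runner is the charge, up to a constant. -/
theorem exists_beads_eq {d : ℕ} (hd : 0 < d) (l : BarPartition) : ∃ n : ℕ,
    l.doubling.colLen 0 ≤ d * n ∧ (∀ b, b ∈ l.doubling.normBetaSet d ↔
      (b : ℤ) - (d * n : ℕ) ≠ 0 ∧ (b : ℤ) - (d * n : ℕ) ∈ l.maya) ∧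
    ∀ i, (l.doubling.beads d i : ℤ) = n + l.charge d i := by
  obtain ⟨n, hn, hmem⟩ := l.exists_mem_normBetaSet_iff hd
  refine ⟨n, hn, hmem, fun i => ?_⟩
  generalize hN : d * n = N at *
  have hNi : ((N : ℤ) : ZMod d) = 0 := by
    rw [← hN]
    simp
  set W : Finset ℤ := Finset.Icc (-(N : ℤ)) (N + l.bound) with hW
  have h1 := charge_eq_sum d l i W (by
    intro x hx
    have := l.le_colLen_of_mem_parts hx
    rw [hW, Finset.mem_Icc]
    omega)
  have h2 : l.doubling.beads d i =
      ((W.filter (fun x : ℤ => (x : ZMod d) = i)).filter (fun x => x ≠ 0 ∧ x ∈ l.maya)).card := by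
    refine Finset.card_bij (fun b _ => (b : ℤ) - N) ?_ (fun a _ b _ h => by simpa using h) ?_
    · intro b hb
      rw [Finset.mem_filter, hmem] at hb
      have := le_bound_of_mem_maya hb.1.2
      refine Finset.mem_filter.2 ⟨Finset.mem_filter.2 ⟨?_, ?_⟩, hb.1⟩
      · rw [hW, Finset.mem_Icc]
        omega
      · rw [Int.cast_sub, hNi, sub_zero, Int.cast_natCast, hb.2]
    · intro x hx
      rw [Finset.mem_filter, Finset.mem_filter, hW, Finset.mem_Icc] at hx
      obtain ⟨⟨hx1, hx2⟩, hx3⟩ := hx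
      have e : (((x + N).toNat : ℕ) : ℤ) = x + N := by omega
      refine ⟨(x + N).toNat, ?_, by omega⟩
      rw [Finset.mem_filter, hmem, e, ← Int.cast_natCast (R := ZMod d), e, Int.cast_add, hNi,
        add_zero, add_sub_cancel_right]
      exact ⟨hx3, hx2⟩
  have h3 : (W.filter (fun x : ℤ => (x : ZMod d) = i)).filter (fun x => x < 0) =
      (Finset.Ico (-(d * n : ℕ) : ℤ) 0).filter (fun x : ℤ => (x : ZMod d) = i) := by
    ext x
    simp only [hW, hN, Finset.mem_filter, Finset.mem_Icc, Finset.mem_Ico]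
    constructor
    · rintro ⟨⟨h, h'⟩, h''⟩
      exact ⟨by omega, h'⟩
    · rintro ⟨h, h'⟩
      exact ⟨⟨by omega, h'⟩, by omega⟩
  have h4 := card_Ico_filter_cast hd n i
  rw [← h3, ← Finset.sum_boole] at h4
  rw [h2, ← h1, ← Finset.sum_boole]
  conv_rhs => rw [← h4]
  rw [← Finset.sum_add_distrib]
  refine Finset.sum_congr rfl fun x _ => ?_
  rcases lt_trichotomy x 0 with h | rfl | h
  · simp [h, h.le, h.ne]
  · simp [l.zero_mem_maya]
  · simp [h.not_ge, h.not_gt, h.ne']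

theorem beads_sub_beads {d : ℕ} (hd : 0 < d) (l : BarPartition) (i j : ZMod d) :
    (l.doubling.beads d i : ℤ) - l.doubling.beads d j = l.charge d i - l.charge d j := by
  obtain ⟨n, -, -, h⟩ := l.exists_beads_eq hd
  rw [h, h]
  ring

/-- The Maya diagram of a component of the quotient: the runner, moved back by its charge. -/
theorem mem_betaMaya_runner {d : ℕ} (l : BarPartition) {i : ℕ} (hi : i < d) (v : ℤ) :
    v ∈ YoungDiagram.betaMaya (l.doubling.runner d i) ↔
      slide d (l.charge d) (d * v + i) ≠ 0 ∧ slide d (l.charge d) (d * v + i) ∈ l.maya := by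
  have hd : 0 < d := by omega
  obtain ⟨n, hn, hmem, hb⟩ := l.exists_beads_eq hd
  have hres : ((d * v + i : ℤ) : ZMod d) = (i : ZMod d) := by simp
  have hmod : ∀ a : ℕ, a % d = i ↔ (a : ZMod d) = (i : ZMod d) := by
    intro a
    rw [ZMod.natCast_eq_natCast_iff', Nat.mod_eq_of_lt hi]
  have hcard : ((l.doubling.runner d i).card : ℤ) = n + l.charge d (i : ZMod d) := by
    rw [← hb, YoungDiagram.runner, Finset.card_image_of_injOn]
    · simp only [hmod]
      rfl
    · intro a ha b hb h
      have ha' := (Finset.mem_filter.1 ha).2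
      have hb' := (Finset.mem_filter.1 hb).2
      simp only at h
      rw [← Nat.div_add_mod a d, ← Nat.div_add_mod b d, ha', hb', h]
  have hrun : ∀ m : ℕ, m ∈ l.doubling.runner d i ↔ d * m + i ∈ l.doubling.normBetaSet d := by
    intro m
    rw [YoungDiagram.runner, Finset.mem_image]
    constructor
    · rintro ⟨a, ha, rfl⟩
      obtain ⟨ha, rfl⟩ := Finset.mem_filter.1 ha
      rwa [Nat.div_add_mod]
    · intro h
      refine ⟨d * m + i, Finset.mem_filter.2 ⟨h, ?_⟩, ?_⟩
      · rw [Nat.mul_add_mod, Nat.mod_eq_of_lt hi]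
      · rw [Nat.mul_add_div hd, Nat.div_eq_of_lt hi, add_zero]
  have hs : slide d (l.charge d) (d * v + i) =
      d * (v + (l.doubling.runner d i).card) + i - (d * n : ℕ) := by
    rw [slide, hres, hcard]
    push_cast
    ring
  rw [YoungDiagram.betaMaya, Set.mem_ofPred_eq, hs]
  rcases lt_or_ge (v + ((l.doubling.runner d i).card : ℤ)) 0 with h | h
  · refine iff_of_true (Or.inl h) ?_
    rw [← exists_rowBead_iff]
    refine l.doubling.exists_rowBead_of_lt ?_
    have : (d : ℤ) * (v + (l.doubling.runner d i).card) ≤ d * (-1) :=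
      mul_le_mul_of_nonneg_left (by omega) (by omega)
    omega
  · obtain ⟨m, hm⟩ := Int.eq_ofNat_of_zero_le h
    rw [hm, Int.toNat_natCast, hrun, hmem]
    push_cast
    exact or_iff_right (by omega)

/-! ### The bar quotient partition -/

theorem isBarQuotientPartition_iff {d : ℕ} (hd : Odd d) (l q : BarPartition) :
    IsBarQuotientPartition d l q ↔
      q.charge d = 0 ∧ ∀ x, x ∈ q.maya ↔ slide d (l.charge d) x ∈ l.maya := by
  rw [IsBarQuotientPartition, isBarCore_empty_iff hd]
  refine and_congr_right fun hq => ?_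
  have hd0 : 0 < d := hd.pos
  have h0 : ∀ x, slide d 0 x = x := fun x => by simp [slide]
  have hodd := charge_neg d l
  have hcomp : ∀ i ≤ (d - 1) / 2,
      (q.doubling.quotientComponent d i = l.doubling.quotientComponent d i ↔
        ∀ v : ℤ, (d * v + i : ℤ) ≠ 0 →
          ((d * v + i : ℤ) ∈ q.maya ↔ slide d (l.charge d) (d * v + i) ∈ l.maya)) := by
    intro i hi
    rw [YoungDiagram.quotientComponent, YoungDiagram.quotientComponent,
      YoungDiagram.partitionOfBeta_eq_iff]
    refine forall_congr' fun v => ?_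
    rw [mem_betaMaya_runner q (by omega), mem_betaMaya_runner l (by omega), hq, h0]
    rw [ne_eq, ne_eq, slide_eq_zero hodd, and_congr_right_iff]
  constructor
  · -- the classes `i > (d - 1) / 2` are the negatives of those in the bar quotient
    intro h
    have key : ∀ x : ℤ, x ≠ 0 → x % d ≤ (d - 1) / 2 →
        (x ∈ q.maya ↔ slide d (l.charge d) x ∈ l.maya) := by
      intro x hx hle
      have hnn := Int.emod_nonneg x (show (d : ℤ) ≠ 0 by omega)
      have hi : (x % d).toNat ≤ (d - 1) / 2 := by omega
      have := (hcomp _ hi).1 (h _ hi) (x / d)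
      rw [Int.toNat_of_nonneg hnn, Int.mul_ediv_add_emod] at this
      exact this hx
    intro x
    rcases eq_or_ne x 0 with rfl | hx
    · rw [slide_zero hodd]
      exact iff_of_true q.zero_mem_maya l.zero_mem_maya
    by_cases hle : x % d ≤ (d - 1) / 2
    · exact key x hx hle
    · have hneg : (-x) % d ≤ (d - 1) / 2 := by
        have h1 : (-x) % d = d - x % d := by
          have h2 : (-x) = (d - x % d) + d * (-(x / d) - 1) := by
            have := Int.mul_ediv_add_emod x d
            linarith
          rw [h2, Int.add_mul_emod_self_left, Int.emod_eq_of_lt]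
          · have := Int.emod_lt_of_pos x (show (0 : ℤ) < d by omega)
            omega
          · omega
        obtain ⟨t, ht⟩ := hd
        omega
      have := key (-x) (by omega) hneg
      rw [slide_neg hodd, neg_mem_maya hx, neg_mem_maya ((slide_eq_zero hodd).not.2 hx)] at this
      exact not_iff_not.1 this
  · intro h i hi
    exact (hcomp i hi).2 fun v _ => h _

theorem exists_isBarQuotientPartition {d : ℕ} (hd : Odd d) (l : BarPartition) :
    ∃ q, IsBarQuotientPartition d l q := by
  have hd0 : 0 < d := hd.pos
  have hodd := charge_neg d l
  have habs : ∀ i, |l.charge d i * d| ≤ l.parts.card * d := by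
    intro i
    rw [abs_mul, Nat.abs_cast]
    exact mul_le_mul_of_nonneg_right (abs_charge_le d l i) (by omega)
  generalize hM : (l.parts.card * d : ℤ) = M at habs
  have hM0 : 0 ≤ M := hM ▸ by positivity
  let q : BarPartition := ⟨(Finset.Icc 1 (l.bound + M.toNat)).filter fun a : ℕ =>
    slide d (l.charge d) a ∈ l.maya, fun a ha =>
      (Finset.mem_Icc.1 (Finset.mem_filter.1 ha).1).1⟩
  have hpos : ∀ x : ℤ, 0 < x → (x ∈ q.maya ↔ slide d (l.charge d) x ∈ l.maya) := by
    intro x hx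
    have e : ((x.natAbs : ℕ) : ℤ) = x := by omega
    rw [mem_maya_of_pos hx, Finset.mem_filter, Finset.mem_Icc, e, and_iff_right_iff_imp]
    intro h
    have h1 := le_bound_of_mem_maya h
    have h2 := abs_le.1 (habs (x : ZMod d))
    rw [slide] at h1
    omega
  have hq : ∀ x, x ∈ q.maya ↔ slide d (l.charge d) x ∈ l.maya := by
    intro x
    rcases lt_trichotomy x 0 with hx | rfl | hx
    · have := hpos (-x) (by omega)
      rw [slide_neg hodd, neg_mem_maya hx.ne,
        neg_mem_maya ((slide_eq_zero hodd).not.2 hx.ne)] at this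
      exact not_iff_not.1 this
    · rw [slide_zero hodd]
      exact iff_of_true q.zero_mem_maya l.zero_mem_maya
    · exact hpos x hx
  refine ⟨q, (isBarQuotientPartition_iff hd l q).2 ⟨funext fun i => ?_, hq⟩⟩
  have hb : q.bound ≤ l.bound + M.toNat := Finset.sup_le fun a ha =>
    (Finset.mem_Icc.1 (Finset.mem_filter.1 ha).1).2
  set W : Finset ℤ := Finset.Icc (-(l.bound + M)) (l.bound + M) with hW
  have h1 := charge_eq_sum d q i W (by
    intro x hx
    have := le_bound hx
    rw [hW, Finset.mem_Icc]
    omega)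
  have h2 := sum_shifted_halfLine hd0 (-l.charge d i) i W (by
    intro x hx
    have := habs i
    rw [abs_mul, Nat.abs_cast] at this
    rw [abs_neg, abs_le] at hx
    rw [hW, Finset.mem_Icc]
    omega)
  have h3 := charge_eq_sum d l i (W.image (slide d (l.charge d))) (by
    intro x hx
    have h1 := le_bound hx
    have h2 := abs_le.1 (habs (x : ZMod d))
    refine Finset.mem_image.2 ⟨slide d (-l.charge d) x, ?_, slide_slide_neg x⟩
    rw [hW, Finset.mem_Icc, slide, Pi.neg_apply]
    constructor <;> linarith [neg_abs_le x, le_abs_self x, Int.abs_eq_natAbs x,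
      (show (x.natAbs : ℤ) ≤ l.bound by exact_mod_cast h1)])
  rw [Finset.filter_image, Finset.sum_image (fun _ _ _ _ h => slide_injective h)] at h3
  simp only [slide_cast] at h3
  have h4 := (congrArg₂ (· + ·) h2 h3).trans (neg_add_cancel _)
  simp only [← Finset.sum_add_distrib] at h4
  refine h1.symm.trans (Eq.trans ?_ h4)
  refine Finset.sum_congr rfl fun x hx => ?_
  have e : slide d (l.charge d) x = x - -l.charge d i * d := by
    rw [slide, (Finset.mem_filter.1 hx).2]
    ring
  rw [e]
  have := hq x
  rw [e] at this
  simp only [this]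
  ring

theorem existsUnique_isBarQuotientPartition {d : ℕ} (hd : Odd d) (l : BarPartition) :
    ∃! q, IsBarQuotientPartition d l q := by
  obtain ⟨q, hq⟩ := exists_isBarQuotientPartition hd l
  refine ⟨q, hq, fun q' hq' => eq_of_maya_eq fun x => ?_⟩
  rw [((isBarQuotientPartition_iff hd l q).1 hq).2, ((isBarQuotientPartition_iff hd l q').1 hq').2]

/-! ### Modified bar lengths in terms of Maya diagrams -/

theorem modHook_eq {d : ℕ} (hd : 0 < d) (l q : BarPartition) {z : ℕ × ℕ} (hz : z ∈ q.doubling) :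
    modHook d l q z = slide d (l.charge d) (q.doubling.rowBead z.1) +
      slide d (l.charge d) (-q.doubling.colGap z.2) := by
  rw [modHook, YoungDiagram.handResidue_eq _ _ hz, YoungDiagram.footResidue_sub_one_eq _ _ hz,
    beads_sub_beads hd, YoungDiagram.hookLen_eq, slide_neg (charge_neg d l), slide, slide]
  ring

theorem modBarLengths_eq {d : ℕ} (hd : 0 < d) (l q : BarPartition) :
    modBarLengths d l q = q.barPairs.val.map fun p =>
      (slide d (l.charge d) p.1 + slide d (l.charge d) p.2).natAbs := by
  rw [← map_shiftedCells, modBarLengths]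
  exact Multiset.map_congr rfl fun z hz => by
    rw [modHook_eq hd l q (Finset.mem_filter.1 hz).1]

theorem mem_modPartLengths {d : ℕ} (hd : 0 < d) (l q : BarPartition) (k : ℕ) :
    k ∈ modPartLengths d l q ↔
      ∃ x ∈ q.maya, 0 < x ∧ (slide d (l.charge d) x).natAbs = k := by
  have key : ∀ z ∈ q.partCells,
      modHook d l q z = slide d (l.charge d) (q.doubling.rowBead z.1) := by
    intro z hz
    rw [modHook_eq hd l q (Finset.mem_filter.1 hz).1, ((q.mem_partCells).1 hz).1, colGap_card,
      neg_zero, slide_zero (charge_neg d l), add_zero]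
  rw [modPartLengths, Multiset.mem_map]
  constructor
  · rintro ⟨z, hz, rfl⟩
    obtain ⟨h1, h2⟩ := (q.exists_mem_partCells_iff _).1 ⟨z, hz, rfl⟩
    exact ⟨_, h2, h1, by rw [key z hz]⟩
  · rintro ⟨x, hx, hpos, rfl⟩
    obtain ⟨z, hz, rfl⟩ := (q.exists_mem_partCells_iff x).2 ⟨hpos, hx⟩
    exact ⟨z, hz, by rw [key z hz]⟩

theorem commonParts_le_modBarLengths (d : ℕ) (l c q : BarPartition) :
    commonParts d l c q ≤ modBarLengths d l q :=
  (Multiset.inter_le_right).trans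
    (Multiset.map_le_map (Finset.val_le_iff.2 q.partCells_subset_shiftedCells))

theorem commonParts_nodup (d : ℕ) (l c q : BarPartition) : (commonParts d l c q).Nodup :=
  Multiset.nodup_of_le Multiset.inter_le_left c.parts.nodup

/-- A common value `k` is a part of the core, so that `k` slides back to a negative number, for
which `-k` belongs to the Maya diagram. -/
theorem mem_commonParts {d : ℕ} (hd : Odd d) {l c q : BarPartition} (hc : IsBarCore d l c)
    (hq : ∀ x, x ∈ q.maya ↔ slide d (l.charge d) x ∈ l.maya) {k : ℕ} (hk : 0 < k) :
    k ∈ commonParts d l c q ↔ slide d (-l.charge d) k < 0 ∧ (k : ℤ) ∉ l.maya := by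
  have hodd := charge_neg d l
  have hodd' : ∀ i, (-l.charge d) (-i) = -(-l.charge d) i := fun i => by simp [hodd]
  have hne : slide d (-l.charge d) k ≠ 0 := (slide_eq_zero hodd').not.2 (by omega)
  rw [commonParts, Multiset.mem_inter, Finset.mem_val, ← natCast_mem_maya hk,
    hc.mem_maya_iff hd, mem_modPartLengths hd.pos]
  constructor
  · rintro ⟨h, x, hx, hpos, habs⟩
    refine ⟨lt_of_le_of_ne h hne, ?_⟩
    rw [hq] at hx
    rcases Int.natAbs_eq_iff.1 habs with e | e
    · have := slide_neg_slide (d := d) (c := l.charge d) x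
      rw [e] at this
      omega
    · rw [e, neg_mem_maya (by omega)] at hx
      exact hx
  · rintro ⟨h, hA⟩
    have e : slide d (l.charge d) (-slide d (-l.charge d) k) = -k := by
      rw [slide_neg hodd, slide_slide_neg]
    refine ⟨h.le, -slide d (-l.charge d) k, ?_, by omega, by omega⟩
    rwa [hq, e, neg_mem_maya (by omega)]

/-! ### Counting pairs with a given sum -/

/-- The bars with modified length `e`, as ordered pairs `(x, e - x)` or `(e - x, x)`. -/
theorem card_eq_two_mul_card_barPairs (q : BarPartition) {φ ψ : ℤ → ℤ} (hψφ : ∀ x, ψ (φ x) = x)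
    (hφψ : ∀ x, φ (ψ x) = x) (e : ℤ) (Z : Finset ℤ)
    (hZ : ∀ x, x ∈ Z ↔ ψ x ∈ q.maya ∧ ψ (e - x) ∈ q.maya ∧ x ≠ e - x ∧ 0 < ψ x + ψ (e - x)) :
    Z.card = 2 * (q.barPairs.filter fun p => φ p.1 + φ p.2 = e).card := by
  have h1 : (q.barPairs.filter fun p => φ p.1 + φ p.2 = e).card =
      (Z.filter fun x => ψ (e - x) < ψ x).card := by
    refine Finset.card_bij (fun p _ => φ p.1) ?_ ?_ ?_
    · rintro ⟨u, v⟩ hp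
      obtain ⟨hp, hs⟩ := Finset.mem_filter.1 hp
      obtain ⟨hu, hv, hlt, hpos⟩ := mem_barPairs.1 hp
      simp only at hs hu hv hlt hpos ⊢
      have e1 : e - φ u = φ v := by omega
      rw [Finset.mem_filter, hZ, e1, hψφ, hψφ]
      refine ⟨⟨hu, hv, fun h => ?_, hpos⟩, hlt⟩
      rw [← hψφ u, ← hψφ v, h] at hlt
      exact hlt.false
    · rintro ⟨u, v⟩ hp ⟨u', v'⟩ hp' h
      have hs := (Finset.mem_filter.1 hp).2
      have hs' := (Finset.mem_filter.1 hp').2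
      simp only at hs hs' h
      rw [← hψφ u, ← hψφ v, ← hψφ u', ← hψφ v', h, show φ v = φ v' by omega]
    · intro x hx
      rw [Finset.mem_filter, hZ] at hx
      refine ⟨(ψ x, ψ (e - x)), ?_, hφψ x⟩
      rw [Finset.mem_filter, mem_barPairs, hφψ, hφψ]
      exact ⟨⟨hx.1.1, hx.1.2.1, hx.2, hx.1.2.2.2⟩, by omega⟩
  have h2 : (Z.filter fun x => ψ (e - x) < ψ x).card =
      (Z.filter fun x => ¬ ψ (e - x) < ψ x).card := by
    refine Finset.card_bij (fun x _ => e - x) ?_ (fun x _ y _ h => by omega) ?_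
    · intro x hx
      rw [Finset.mem_filter, hZ] at hx
      rw [Finset.mem_filter, hZ, sub_sub_cancel]
      exact ⟨⟨hx.1.2.1, hx.1.1, hx.1.2.2.1.symm, by omega⟩, by omega⟩
    · intro x hx
      rw [Finset.mem_filter, hZ] at hx
      refine ⟨e - x, ?_, sub_sub_cancel _ _⟩
      rw [Finset.mem_filter, hZ, sub_sub_cancel]
      refine ⟨⟨hx.1.2.1, hx.1.1, hx.1.2.2.1.symm, by omega⟩, ?_⟩
      refine lt_of_le_of_ne (not_lt.1 hx.2) fun h => hx.1.2.2.1 ?_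
      have := congrArg φ h
      rwa [hφψ, hφψ] at this
  rw [← Finset.card_filter_add_card_filter_not (s := Z) (fun x => ψ (e - x) < ψ x), ← h2, ← h1]
  ring

theorem two_mul_count_barLengths (l : BarPartition) {k : ℕ} (hk : 0 < k) (W : Finset ℤ)
    (hW : ∀ x, x ∈ l.maya → k - x ∈ l.maya → x ∈ W) :
    (2 * l.barLengths.count k : ℤ) =
      ∑ x ∈ W, if x ∈ l.maya ∧ k - x ∈ l.maya ∧ x ≠ k - x then 1 else 0 := by
  rw [Finset.sum_boole, card_eq_two_mul_card_barPairs l (φ := id) (ψ := id) (fun _ => rfl)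
    (fun _ => rfl) k, barLengths_eq, Multiset.count_map]
  · push_cast
    congr 2
    change (l.barPairs.filter fun p : ℤ × ℤ => k = (p.1 + p.2).natAbs).card = _
    congr 1
    refine Finset.filter_congr fun p hp => ?_
    have := (mem_barPairs.1 hp).2.2.2
    simp only [id]
    omega
  · intro x
    simp only [Finset.mem_filter, id]
    constructor
    · rintro ⟨-, h1, h2, h3⟩
      exact ⟨h1, h2, h3, by omega⟩
    · rintro ⟨h1, h2, h3, -⟩
      exact ⟨hW x h1 h2, h1, h2, h3⟩

/-- Twice the number of modified bar lengths equal to `k`: the pairs with sum `k` that slide back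
to a positive sum, and the negatives of those with sum `-k`. -/
theorem two_mul_count_modBarLengths {d : ℕ} (hd : 0 < d) {l q : BarPartition}
    (hq : ∀ x, x ∈ q.maya ↔ slide d (l.charge d) x ∈ l.maya) {k : ℕ} (hk : 0 < k)
    (W : Finset ℤ) (hW : ∀ x, x ∈ l.maya → k - x ∈ l.maya → x ∈ W)
    (hW' : ∀ x, -x ∈ l.maya → x - k ∈ l.maya → x ∈ W) :
    (2 * (modBarLengths d l q).count k : ℤ) =
      (∑ x ∈ W, if x ∈ l.maya ∧ k - x ∈ l.maya ∧ x ≠ k - x ∧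
        0 < slide d (-l.charge d) x + slide d (-l.charge d) (k - x) then 1 else 0) +
      ∑ x ∈ W, if -x ∈ l.maya ∧ x - k ∈ l.maya ∧ x ≠ k - x ∧
        slide d (-l.charge d) x + slide d (-l.charge d) (k - x) < 0 then 1 else 0 := by
  have hodd := charge_neg d l
  have hodd' : ∀ i, (-l.charge d) (-i) = -(-l.charge d) i := fun i => by simp [hodd]
  have hq' : ∀ x, slide d (-l.charge d) x ∈ q.maya ↔ x ∈ l.maya := fun x => by
    rw [hq, slide_slide_neg]
  have hcount : (modBarLengths d l q).count k =
      (q.barPairs.filter fun p =>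
        slide d (l.charge d) p.1 + slide d (l.charge d) p.2 = k).card +
      (q.barPairs.filter fun p =>
        slide d (l.charge d) p.1 + slide d (l.charge d) p.2 = -k).card := by
    rw [modBarLengths_eq hd, Multiset.count_map, ← Finset.card_union_of_disjoint,
      ← Finset.filter_or]
    · change (q.barPairs.filter fun p : ℤ × ℤ => k = (slide d (l.charge d) p.1 +
        slide d (l.charge d) p.2).natAbs).card = _
      congr 1
      refine Finset.filter_congr fun p _ => ?_
      omega
    · rw [Finset.disjoint_filter]
      intro p _ h
      omega
  rw [hcount, Nat.cast_add, mul_add, Finset.sum_boole, Finset.sum_boole]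
  congr 1
  · rw [card_eq_two_mul_card_barPairs q (φ := slide d (l.charge d))
      (ψ := slide d (-l.charge d)) slide_neg_slide slide_slide_neg k]
    · push_cast
      rfl
    · intro x
      simp only [Finset.mem_filter, hq', and_iff_right_iff_imp]
      exact fun h => hW x h.1 h.2.1
  · have hneg : (W.filter fun x => -x ∈ l.maya ∧ x - k ∈ l.maya ∧ x ≠ k - x ∧
        slide d (-l.charge d) x + slide d (-l.charge d) (k - x) < 0).card =
        ((W.filter fun x => -x ∈ l.maya ∧ x - k ∈ l.maya ∧ x ≠ k - x ∧
        slide d (-l.charge d) x + slide d (-l.charge d) (k - x) < 0).image (- ·)).card :=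
      (Finset.card_image_of_injective _ neg_injective).symm
    rw [hneg, card_eq_two_mul_card_barPairs q (φ := slide d (l.charge d))
      (ψ := slide d (-l.charge d)) slide_neg_slide slide_slide_neg (-k)]
    · push_cast
      rfl
    · intro x
      have e2 : -(k : ℤ) - x = -x - k := by ring
      have e3 : slide d (-l.charge d) x = -slide d (-l.charge d) (-x) := by
        rw [slide_neg hodd', neg_neg]
      have e4 : ∀ y, slide d (-l.charge d) (y - k) = -slide d (-l.charge d) (k - y) := fun y => by
        rw [← slide_neg hodd', neg_sub]
      rw [hq', hq', e3, e2, e4]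
      simp only [Finset.mem_image, Finset.mem_filter]
      constructor
      · rintro ⟨y, ⟨-, h1, h2, h3, h4⟩, rfl⟩
        simp only [neg_neg]
        exact ⟨h1, h2, by omega, by omega⟩
      · rintro ⟨h1, h2, h3, h4⟩
        refine ⟨-x, ⟨hW' _ (by rwa [neg_neg]) h2, by rwa [neg_neg], h2, by omega, by omega⟩,
          neg_neg x⟩

/-- Bar partitions with the same charges have the same number of elements in each class, so a
class function has the same sum over both Maya diagrams. -/
theorem sum_class_function_eq_zero {d : ℕ} [NeZero d] {l c : BarPartition}
    (h : c.charge d = l.charge d) (g : ZMod d → ℤ) (W : Finset ℤ)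
    (hl : ∀ x : ℤ, x.natAbs ∈ l.parts → x ∈ W) (hc : ∀ x : ℤ, x.natAbs ∈ c.parts → x ∈ W) :
    ∑ x ∈ W, g x * ((if x ∈ l.maya then 1 else 0) - (if x ∈ c.maya then 1 else 0)) = 0 := by
  rw [← Finset.sum_fiberwise W (fun x : ℤ => (x : ZMod d))]
  refine Finset.sum_eq_zero fun i _ => ?_
  have h1 := charge_eq_sum d l i W hl
  have h2 := charge_eq_sum d c i W hc
  rw [h, ← h1, eq_comm, ← sub_eq_zero, ← Finset.sum_sub_distrib] at h2
  refine Eq.trans ?_ ((congrArg (g i * ·) h2).trans (mul_zero _))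
  simp only [Finset.mul_sum]
  refine Finset.sum_congr rfl fun x hx => ?_
  rw [(Finset.mem_filter.1 hx).2]
  rw [sub_sub_sub_cancel_right]

theorem sum_single_ite (W : Finset ℤ) {y : ℤ} (hy : y ∈ W) (p : Prop) [Decidable p] :
    ∑ x ∈ W, (if x = y ∧ p then (1 : ℤ) else 0) = if p then 1 else 0 := by
  by_cases hp : p <;> simp [hp, hy]

/-- The relation between the numbers of bars of length `k` of a bar partition, of its core, and of
modified bars of its quotient partition. -/
theorem count_barLengths_eq {d : ℕ} (hd : Odd d) {l c q : BarPartition} (hc : IsBarCore d l c)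
    (hq : ∀ x, x ∈ q.maya ↔ slide d (l.charge d) x ∈ l.maya) {k : ℕ} (hk : 0 < k) :
    (l.barLengths.count k : ℤ) = c.barLengths.count k + (modBarLengths d l q).count k -
      (commonParts d l c q).count k + ((commonParts d l c q).map (fun a => 2 * a)).count k := by
  have hd0 : 0 < d := hd.pos
  have : NeZero d := ⟨hd0.ne'⟩
  have hodd := charge_neg d l
  have hodd' : ∀ i, (-l.charge d) (-i) = -(-l.charge d) i := fun i => by simp [hodd]
  have hCmem := hc.mem_maya_iff hd
  have hk0 : (k : ℤ) ≠ 0 := by omega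
  set ψ := slide d (-l.charge d) with hψ
  have hψ0 : ψ 0 = 0 := slide_zero hodd'
  -- the window of summation is symmetric under `x ↦ k - x`
  set L : ℤ := l.bound + c.bound with hL
  set W : Finset ℤ := Finset.Icc (-L) (L + k) with hW
  have hWsymm : ∀ x, x ∈ W ↔ k - x ∈ W := fun x => by
    simp only [hW, Finset.mem_Icc]
    omega
  have hWl : ∀ x, x ∈ l.maya → k - x ∈ l.maya → x ∈ W := fun x h1 h2 => by
    have := le_bound_of_mem_maya h1
    have := le_bound_of_mem_maya h2
    rw [hW, Finset.mem_Icc]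
    omega
  have hWl' : ∀ x, -x ∈ l.maya → x - k ∈ l.maya → x ∈ W := fun x h1 h2 => by
    have := le_bound_of_mem_maya h1
    have := le_bound_of_mem_maya h2
    rw [hW, Finset.mem_Icc]
    omega
  have hWc : ∀ x, x ∈ c.maya → k - x ∈ c.maya → x ∈ W := fun x h1 h2 => by
    have := le_bound_of_mem_maya h1
    have := le_bound_of_mem_maya h2
    rw [hW, Finset.mem_Icc]
    omega
  have hWlp : ∀ x : ℤ, x.natAbs ∈ l.parts → x ∈ W := fun x h => by
    have := le_bound h
    rw [hW, Finset.mem_Icc]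
    omega
  have hWcp : ∀ x : ℤ, x.natAbs ∈ c.parts → x ∈ W := fun x h => by
    have := le_bound h
    rw [hW, Finset.mem_Icc]
    omega
  have s1 := two_mul_count_barLengths l hk W hWl
  have s2 := two_mul_count_modBarLengths hd0 hq hk W hWl hWl'
  have s3 := two_mul_count_barLengths c hk W hWc
  -- the sign of `ψ x + ψ (k - x)` depends only on the class of `x`
  set f : ℤ → ℤ := fun x => (if ψ x + ψ (k - x) < 0 then 1 else 0) *
    ((if x ∈ l.maya then 1 else 0) - (if x ∈ c.maya then 1 else 0)) with hf
  have s4 : ∑ x ∈ W, f x = 0 := by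
    rw [← sum_class_function_eq_zero hc.charge_eq (fun i : ZMod d =>
      if (k : ℤ) - (l.charge d i + l.charge d (k - i)) * d < 0 then 1 else 0) W hWlp hWcp]
    refine Finset.sum_congr rfl fun x _ => ?_
    have : ψ x + ψ (k - x) = (k : ℤ) - (l.charge d x + l.charge d (k - x)) * d := by
      simp only [hψ, slide, Pi.neg_apply, Int.cast_sub, Int.cast_natCast]
      ring
    simp only [hf, this]
  have s5 : ∑ x ∈ W, f (k - x) = 0 := by
    rw [← s4]
    exact Finset.sum_equiv (Equiv.subLeft (k : ℤ)) hWsymm fun _ _ => rfl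
  have hkW : (k : ℤ) ∈ W := by
    rw [hW, Finset.mem_Icc]
    omega
  have h0W : (0 : ℤ) ∈ W := by
    rw [hW, Finset.mem_Icc]
    omega
  have s6 := sum_single_ite W hkW (ψ k < 0 ∧ (k : ℤ) ∉ l.maya)
  have s7 := sum_single_ite W h0W (ψ k < 0 ∧ (k : ℤ) ∉ l.maya)
  have hcom : ((commonParts d l c q).count k : ℤ) =
      if ψ k < 0 ∧ (k : ℤ) ∉ l.maya then 1 else 0 := by
    rw [Multiset.count_eq_of_nodup (commonParts_nodup d l c q)]
    simp only [mem_commonParts hd hc hq hk, ← hψ]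
    split_ifs <;> rfl
  have hdbl : (((commonParts d l c q).map (fun a => 2 * a)).count k : ℤ) =
      ∑ x ∈ W, if x = k - x ∧ ψ x < 0 ∧ x ∉ l.maya then 1 else 0 := by
    have hinj : Function.Injective (fun a : ℕ => 2 * a) := fun a b h => by
      simp only at h
      omega
    rcases Nat.even_or_odd' k with ⟨t, rfl | rfl⟩
    · have ht : (t : ℤ) ∈ W := by
        rw [hW, Finset.mem_Icc]
        push_cast
        omega
      rw [Multiset.count_map_eq_count' _ _ hinj,
        Multiset.count_eq_of_nodup (commonParts_nodup d l c q),
        Finset.sum_eq_single (t : ℤ)]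
      · have e : (t : ℤ) = (2 * t : ℕ) - t := by
          push_cast
          ring
        simp only [mem_commonParts hd hc hq (show 0 < t by omega), ← hψ, ← e, true_and]
        split_ifs <;> rfl
      · intro x _ hx
        refine if_neg fun h => hx ?_
        have := h.1
        push_cast at this
        omega
      · exact fun h => absurd ht h
    · rw [Multiset.count_eq_zero_of_notMem, Finset.sum_eq_zero]
      · rfl
      · intro x _
        refine if_neg fun h => ?_
        have := h.1
        push_cast at this
        omega
      · rw [Multiset.mem_map]
        rintro ⟨a, -, ha⟩
        omega
  -- The identity holds term by term: `f x + f (k - x)` accounts for the pairs with negative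
  -- `ψ x + ψ (k - x)`, and the last three terms for the degenerate pairs and for the point `0`.
  suffices hsum : ∑ x ∈ W, ((if x ∈ l.maya ∧ k - x ∈ l.maya ∧ x ≠ k - x then 1 else 0) : ℤ) =
      ∑ x ∈ W, (((((((if x ∈ l.maya ∧ k - x ∈ l.maya ∧ x ≠ k - x ∧ 0 < ψ x + ψ (k - x)
        then 1 else 0) +
      (if -x ∈ l.maya ∧ x - k ∈ l.maya ∧ x ≠ k - x ∧ ψ x + ψ (k - x) < 0 then 1 else 0)) +
      (if x ∈ c.maya ∧ k - x ∈ c.maya ∧ x ≠ k - x then 1 else 0)) + f x) + f (k - x)) +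
      2 * (if x = k - x ∧ ψ x < 0 ∧ x ∉ l.maya then 1 else 0)) -
      (if x = k ∧ ψ k < 0 ∧ (k : ℤ) ∉ l.maya then 1 else 0) -
      (if x = 0 ∧ ψ k < 0 ∧ (k : ℤ) ∉ l.maya then 1 else 0) : ℤ) by
    simp only [Finset.sum_add_distrib, Finset.sum_sub_distrib, ← Finset.mul_sum] at hsum
    rw [← s1, ← s2, ← s3, s4, s5, s6, s7, ← hdbl, ← hcom] at hsum
    linarith
  refine Finset.sum_congr rfl fun x _ => ?_
  have hne : ψ x + ψ (k - x) ≠ 0 := by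
    intro h
    have h1 : ψ (k - x) = ψ (-x) := by
      have h2 : ψ (-x) = -ψ x := slide_neg hodd' x
      omega
    have := slide_injective h1
    omega
  simp only [hf, hCmem, sub_sub_cancel, add_comm (ψ (k - x)) (ψ x)]
  rcases eq_or_ne x 0 with rfl | hx0
  · have h1 : (k : ℤ) - 0 = k := by ring
    have h2 : (0 : ℤ) - k = -k := by ring
    rw [hψ0, h1, zero_add] at hne
    by_cases hA : (k : ℤ) ∈ l.maya <;> rcases lt_or_gt_of_ne hne with h | h <;>
      simp [hψ0, l.zero_mem_maya, neg_mem_maya hk0, hk0.symm, hA, h, h.le, h.not_gt, h.not_ge]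
  rcases eq_or_ne x k with rfl | hxk
  · rw [sub_self, hψ0, add_zero] at hne
    by_cases hA : (k : ℤ) ∈ l.maya <;> rcases lt_or_gt_of_ne hne with h | h <;>
      simp [hψ0, l.zero_mem_maya, neg_mem_maya hk0, hk.ne', hA, h, h.le, h.not_gt, h.not_ge]
  rcases eq_or_ne x (k - x) with hxx | hxx
  · rw [← hxx] at hne ⊢
    rcases lt_or_gt_of_ne hne with h | h
    · have h' : ψ x < 0 := by omega
      by_cases hA : x ∈ l.maya <;> simp [hx0, hxk, hA, h, h'.le, h']
    · have h' : ¬ ψ x < 0 := by omega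
      simp [hx0, hxk, h.not_gt, h']
  · have h1 : x - k = -(k - x) := by ring
    have h2 : (k : ℤ) - x ≠ 0 := by omega
    rw [h1]
    simp only [neg_mem_maya hx0, neg_mem_maya h2]
    by_cases hA : x ∈ l.maya <;> by_cases hB : (k : ℤ) - x ∈ l.maya <;>
      rcases lt_or_gt_of_ne hne with h | h <;>
      by_cases hu : ψ x ≤ 0 <;> by_cases hv : ψ (k - x) ≤ 0 <;>
      first
      | (exfalso; omega)
      | simp [hx0, hxk, hxx, hA, hB, h, h.not_gt, hu, hv]

end BarPartition

theorem theorem4p1 (d : ℕ) (hd : Odd d) (hd3 : 3 ≤ d) (l : BarPartition) :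
    (∃! c : BarPartition, BarPartition.IsBarCore d l c) ∧
    (∃! q : BarPartition, BarPartition.IsBarQuotientPartition d l q) ∧
    ∀ c q : BarPartition,
      BarPartition.IsBarCore d l c →
      BarPartition.IsBarQuotientPartition d l q →
        BarPartition.commonParts d l c q ≤ BarPartition.modBarLengths d l q ∧
        l.barLengths = c.barLengths + BarPartition.adjBarLengths d l c q := by
  refine ⟨BarPartition.existsUnique_isBarCore hd l,
    BarPartition.existsUnique_isBarQuotientPartition hd l, fun c q hc hq => ?_⟩
  have hle := BarPartition.commonParts_le_modBarLengths d l c q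
  have hq' := ((BarPartition.isBarQuotientPartition_iff hd l q).1 hq).2
  refine ⟨hle, Multiset.ext.2 fun k => ?_⟩
  rw [BarPartition.adjBarLengths, Multiset.count_add, Multiset.count_add, Multiset.count_sub]
  have hlek := Multiset.count_le_of_le k hle
  rcases Nat.eq_zero_or_pos k with rfl | hk
  · have h1 : ∀ m : BarPartition, m.barLengths.count 0 = 0 := fun m =>
      Multiset.count_eq_zero_of_notMem fun h => (BarPartition.mem_barLengths.1 h).1.false
    have h2 : (BarPartition.modBarLengths d l q).count 0 = 0 := by
      refine Multiset.count_eq_zero_of_notMem fun h => ?_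
      rw [BarPartition.modBarLengths_eq hd.pos, Multiset.mem_map] at h
      obtain ⟨p, hp, h⟩ := h
      have hp' := BarPartition.mem_barPairs.1 hp
      have h3 : slide d (l.charge d) p.1 = slide d (l.charge d) (-p.2) := by
        rw [slide_neg (BarPartition.charge_neg d l)]
        omega
      have := slide_injective h3
      omega
    have h3 : ((BarPartition.commonParts d l c q).map (fun a => 2 * a)).count 0 = 0 := by
      refine Multiset.count_eq_zero_of_notMem fun h => ?_
      obtain ⟨a, ha, h⟩ := Multiset.mem_map.1 h
      obtain rfl : a = 0 := by omega
      exact c.zero_notMem_parts (Multiset.mem_inter.1 ha).1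
    have := h1 l
    have := h1 c
    omega
  · have := BarPartition.count_barLengths_eq hd hc hq' hk
    omega
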